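/- Let $n\ge 4$. For a partition $\lambda$ of $n$ let $\psi^{\lambda}$ be the character of the complex Specht module $S^{\lambda}$ of the symmetric group $S_n$ (the span of the polytabloids of shape $\lambda$), and let $\chi^{\lambda}=\psi^{\lambda}\!\downarrow_{A_n}$ be its restriction to the alternating group $A_n$. Let $\chi^{\mathrm{def}}$ be the character of the defining representation $\rho^{\mathrm{def}}$ of $S_n$ on $\mathbb{C}[n]$ by permutation of the basis vectors (so $\chi^{\mathrm{def}}(\pi)$ is the number of fixed points of $\pi$), and let $\chi^{\mathrm{def}}\otimes\chi^{\mathrm{def}}$ be the character of $\rho^{\mathrm{def}}\otimes\rho^{\mathrm{def}}$. Then \[\left(\chi^{\mathrm{def}}\otimes\chi^{\mathrm{def}}\right)\downarrow_{A_n}=2\,\chi^{(n)}+3\,\chi^{(n-1,1)}+\chi^{(n-2,2)}+\chi^{(n-2,1,1)}.\] Moreover, for each $\lambda\in\{(n),(n-1,1),(n-2,2),(n-2,1,1)\}$ that is not equal to its conjugate partition (for $n\ge 6$, all four of them), $\chi^{\lambda}$ is an irreducible character of $A_n$. -/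

import Mathlib

noncomputable section

namespace SpechtTheory

open Equiv

/-- A Young tableau of shape `μ`: a bijective filling of the boxes of `μ` by the `n` letters. -/
abbrev Tableau (n : ℕ) (μ : YoungDiagram) : Type :=
  {c : ℕ × ℕ // c ∈ μ.cells} ≃ Fin n

/-- A tabloid of shape `μ` (a tableau up to permuting the entries of each row), recorded by the
row index of every letter: the `i`-th row has to contain exactly `μ.rowLen i` letters. -/
def Tabloid (n : ℕ) (μ : YoungDiagram) : Type :=
  {r : Fin n → ℕ // ∀ i : ℕ, (Finset.univ.filter fun k => r k = i).card = μ.rowLen i}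

variable {n : ℕ} {μ : YoungDiagram}

/-- `Sₙ` permutes tabloids by acting on the letters. -/
instance : MulAction (Perm (Fin n)) (Tabloid n μ) where
  smul σ r := ⟨fun k => r.1 (σ⁻¹ k), fun i => by
    rw [← r.2 i]
    refine Finset.card_bij (fun k _ => σ⁻¹ k) ?_ ?_ ?_
    · intro k hk
      simpa using hk
    · intro a _ b _ h
      exact σ⁻¹.injective h
    · intro k hk
      exact ⟨σ k, by simpa using hk, by simp⟩⟩
  one_smul r := Subtype.ext (funext fun k => rfl)
  mul_smul σ τ r := Subtype.ext (funext fun k => by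
    change r.1 ((σ * τ)⁻¹ k) = r.1 (τ⁻¹ (σ⁻¹ k))
    rw [mul_inv_rev, Perm.mul_apply])

/-- The action of a permutation on a tableau, by replacing each entry by its image. -/
def Tableau.act (σ : Perm (Fin n)) (T : Tableau n μ) : Tableau n μ := T.trans σ

/-- The tabloid `{T}` of a tableau `T`. -/
def Tableau.tabloid (T : Tableau n μ) : Tabloid n μ :=
  ⟨fun k => (T.symm k).1.1, fun i => by
    rw [YoungDiagram.rowLen_eq_card]
    refine Finset.card_bij (fun k _ => (T.symm k).1) ?_ ?_ ?_
    · intro k hk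
      rw [YoungDiagram.mem_row_iff]
      exact ⟨(T.symm k).2, by simpa using hk⟩
    · intro a _ b _ h
      exact T.symm.injective (Subtype.ext h)
    · intro c hc
      rw [YoungDiagram.mem_row_iff] at hc
      exact ⟨T ⟨c, hc.1⟩, by simpa using hc.2, by simp⟩⟩

theorem Tableau.tabloid_act (σ : Perm (Fin n)) (T : Tableau n μ) :
    Tableau.tabloid (Tableau.act σ T) = σ • Tableau.tabloid T := rfl

/-- The permutations that preserve every column of the tableau `T`. -/
def Tableau.columnStabilizer (T : Tableau n μ) : Finset (Perm (Fin n)) :=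
  Finset.univ.filter fun σ => ∀ k, (T.symm (σ k)).1.2 = (T.symm k).1.2

/-- The permutation representation `M^μ` of `Sₙ` on the tabloids of shape `μ`. -/
def tabloidRep (n : ℕ) (μ : YoungDiagram) :
    Representation ℂ (Perm (Fin n)) (MonoidAlgebra ℂ (Tabloid n μ)) :=
  Representation.ofMulAction ℂ (Perm (Fin n)) (Tabloid n μ)

/-- The polytabloid `e_T = ∑ sgn(σ) {σ T}`, summed over the column stabilizer of `T`. -/
def Tableau.polytabloid (T : Tableau n μ) : MonoidAlgebra ℂ (Tabloid n μ) :=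
  ∑ σ ∈ T.columnStabilizer,
    (((Perm.sign σ : ℤˣ) : ℤ) : ℂ) • MonoidAlgebra.single (Tableau.tabloid (Tableau.act σ T)) (1 : ℂ)

theorem tabloidRep_polytabloid (σ : Perm (Fin n)) (T : Tableau n μ) :
    tabloidRep n μ σ (Tableau.polytabloid T) = Tableau.polytabloid (Tableau.act σ T) := by
  unfold Tableau.polytabloid
  rw [map_sum]
  refine Finset.sum_bij (fun τ _ => σ * τ * σ⁻¹) ?_ ?_ ?_ ?_
  · intro τ hτ
    simp only [Tableau.columnStabilizer, Finset.mem_filter, Finset.mem_univ, true_and] at hτ ⊢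
    intro k
    have := hτ (σ⁻¹ k)
    have h : ∀ j, (Tableau.act σ T).symm j = T.symm (σ⁻¹ j) := fun _ => rfl
    rw [h, h, ← this, ← Perm.mul_apply, ← Perm.mul_apply, ← mul_assoc, ← mul_assoc,
      inv_mul_cancel, one_mul]
  · intro a _ b _ h
    simpa using h
  · intro τ hτ
    refine ⟨σ⁻¹ * τ * σ, ?_, by group⟩
    simp only [Tableau.columnStabilizer, Finset.mem_filter, Finset.mem_univ, true_and] at hτ ⊢
    intro k
    have := hτ (σ k)
    have h : ∀ j, (Tableau.act σ T).symm j = T.symm (σ⁻¹ j) := fun _ => rfl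
    rw [h, h, ← Perm.mul_apply, ← Perm.mul_apply, ← Perm.mul_apply, inv_mul_cancel] at this
    exact this
  · intro τ _
    rw [map_smul, tabloidRep, Representation.ofMulAction_single, Tableau.tabloid_act,
      Tableau.tabloid_act, Tableau.tabloid_act, ← mul_smul, ← mul_smul]
    rcases Int.units_eq_one_or (Perm.sign σ) with h | h <;> simp [h]

/-- The Specht module `S^μ`: the subrepresentation of `M^μ` spanned by all polytabloids. -/
def specht (n : ℕ) (μ : YoungDiagram) : Subrepresentation (tabloidRep n μ) where
  toSubmodule := Submodule.span ℂ (Set.range (Tableau.polytabloid (n := n) (μ := μ)))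
  apply_mem_toSubmodule σ v hv := by
    induction hv using Submodule.span_induction with
    | mem x hx =>
      obtain ⟨T, rfl⟩ := hx
      rw [tabloidRep_polytabloid]
      exact Submodule.subset_span ⟨_, rfl⟩
    | zero => simp
    | add x y _ _ hx hy => rw [map_add]; exact Submodule.add_mem _ hx hy
    | smul a x _ hx => rw [map_smul]; exact Submodule.smul_mem _ a hx

/-- The restriction of a representation of `Sₙ` to the alternating group `Aₙ`. -/
def resAlt {V : Type*} [AddCommGroup V] [Module ℂ V]
    (ρ : Representation ℂ (Perm (Fin n)) V) : Representation ℂ (alternatingGroup (Fin n)) V :=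
  ρ.comp (alternatingGroup (Fin n)).subtype

/-- The representation `D_μ` of `Aₙ` attached to `μ`: the restriction of the Specht module. -/
def altSpecht (n : ℕ) (μ : YoungDiagram) :
    Representation ℂ (alternatingGroup (Fin n)) (specht n μ).toSubmodule :=
  resAlt (specht n μ).toRepresentation

/-- The defining (permutation) representation of `Sₙ` on `ℂ[n]`. -/
def defRep (n : ℕ) : Representation ℂ (Perm (Fin n)) (MonoidAlgebra ℂ (Fin n)) :=
  Representation.ofMulAction ℂ (Perm (Fin n)) (Fin n)

end SpechtTheory

end

/-!
Irreducibility on `Aₙ`. By Maschke it is enough that every `Aₙ`-equivariant endomorphism of `M^μ`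
with values in `S^μ` is a scalar on `S^μ`. Averaging over `Sₙ`, with and without the sign, splits
such an endomorphism into an equivariant and a sign-twisted part. The equivariant part is a scalar
by James's argument. If the twisted part does not vanish on `S^μ`, it maps some `e_T` to a vector
of `S^μ` fixed by the column stabilizer of `T`, which yields a tableau `S` of shape `μ` such that
no two letters share both their column in `S` and their column in `T`; likewise it maps some
tabloid to a vector on which its row stabilizer acts by the sign, which yields the same for rows.
Among the fillings that are injective on the columns of `T`, those of the shape of `T` are exactly
the ones with the least sum of row indices, and the two configurations together force this
minimum, hence `μ = μ'`.

Decomposition. Counting fixed pairs of letters gives `χ_def² = χ_def + χ_{M^(n-2,1,1)}`. Every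
`M^λ` that occurs maps onto a smaller representation with kernel `S^λ`: a linear form that
vanishes on all polytabloids satisfies the alternating relations of a few letters, and these make
it factor through the map. The quotients are `1` for `(n-1,1)`, `M^(n-1,1)` for `(n-2,2)` and
`M^(n-2,2) ⊕ S^(n-1,1)` for `(n-2,1,1)`.
-/

noncomputable section

namespace SpechtTheory

open Equiv Representation

section Tableaux

variable {n : ℕ} {μ : YoungDiagram}

namespace Tableau

/-- The row index of the box of `T` that contains the letter `k`. -/
def row (T : Tableau n μ) (k : Fin n) : ℕ := (T.symm k).1.1

/-- The column index of the box of `T` that contains the letter `k`. -/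
def col (T : Tableau n μ) (k : Fin n) : ℕ := (T.symm k).1.2

/-- The reflection of `T` in the main diagonal, of the conjugate shape. -/
def transpose (T : Tableau n μ) : Tableau n μ.transpose :=
  ((Equiv.prodComm ℕ ℕ).subtypeEquiv fun _ => by simp [YoungDiagram.mem_transpose]).trans T

theorem row_col_injective (T : Tableau n μ) :
    Function.Injective fun k => (T.row k, T.col k) :=
  fun _ _ h => T.symm.injective (Subtype.ext h)

theorem tabloid_apply (T : Tableau n μ) (k : Fin n) : T.tabloid.1 k = T.row k := rfl

theorem mem_columnStabilizer {T : Tableau n μ} {σ : Perm (Fin n)} :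
    σ ∈ T.columnStabilizer ↔ ∀ k, T.col (σ k) = T.col k := by
  simp [columnStabilizer, col]

theorem exists_act_eq (T T' : Tableau n μ) : ∃ σ, T.act σ = T' :=
  ⟨T.symm.trans T', by simp [act, ← Equiv.trans_assoc]⟩

theorem card_row_eq (T : Tableau n μ) (i : ℕ) :
    (Finset.univ.filter fun k => T.row k = i).card = μ.rowLen i :=
  T.tabloid.2 i

theorem sum_col_eq (T T' : Tableau n μ) : ∑ k, T.col k = ∑ k, T'.col k :=
  (Equiv.sum_comp T.symm fun c => c.1.2).trans (Equiv.sum_comp T'.symm fun c => c.1.2).symm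

theorem sum_row_eq (T T' : Tableau n μ) : ∑ k, T.row k = ∑ k, T'.row k :=
  T.transpose.sum_col_eq T'.transpose

theorem sum_cells (T : Tableau n μ) (w : ℕ × ℕ → ℤ) :
    ∑ c ∈ μ.cells, w c = ∑ k, w (T.row k, T.col k) := by
  rw [← Finset.sum_coe_sort, ← Equiv.sum_comp T.symm]
  rfl

theorem sum_row_add_card_sdiff_le (T : Tableau n μ) {f : Fin n → ℕ}
    (hf : Function.Injective fun k => (f k, T.col k)) :
    ∑ k, T.row k + (μ.cells \ Finset.univ.image fun k => (f k, T.col k)).card ≤ ∑ k, f k := by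
  set A := Finset.univ.image fun k => (f k, T.col k)
  -- The weight is negative exactly on `μ`, and every column contributes the same constant to both
  -- fillings.
  let w : ℕ × ℕ → ℤ := fun c => c.1 - μ.colLen c.2
  have hμ : ∑ c ∈ μ.cells \ A, w c ≤ -((μ.cells \ A).card : ℤ) := by
    rw [← mul_neg_one, ← nsmul_eq_mul]
    refine Finset.sum_le_card_nsmul _ _ _ fun c hc => ?_
    have : c.1 < μ.colLen c.2 := YoungDiagram.mem_iff_lt_colLen.1 (Finset.mem_sdiff.1 hc).1
    grind
  have hA : 0 ≤ ∑ c ∈ A \ μ.cells, w c := Finset.sum_nonneg fun c hc => by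
    have : ¬ c.1 < μ.colLen c.2 := fun h =>
      (Finset.mem_sdiff.1 hc).2 (YoungDiagram.mem_iff_lt_colLen.2 h)
    grind
  have hsum : ∑ c ∈ A \ μ.cells, w c - ∑ c ∈ μ.cells \ A, w c =
      ∑ c ∈ A, w c - ∑ c ∈ μ.cells, w c := Finset.sum_sdiff_sub_sum_sdiff
  rw [T.sum_cells, Finset.sum_image hf.injOn, ← Finset.sum_sub_distrib] at hsum
  simp only [w, sub_sub_sub_cancel_right, Finset.sum_sub_distrib] at hsum hμ hA
  zify
  linarith

theorem sum_row_le (T : Tableau n μ) {f : Fin n → ℕ}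
    (hf : Function.Injective fun k => (f k, T.col k)) : ∑ k, T.row k ≤ ∑ k, f k :=
  le_of_add_le_left (T.sum_row_add_card_sdiff_le hf)

theorem exists_row_eq_col_eq (T : Tableau n μ) {f : Fin n → ℕ}
    (hf : Function.Injective fun k => (f k, T.col k)) (h : ∑ k, f k ≤ ∑ k, T.row k) :
    ∃ T' : Tableau n μ, T'.row = f ∧ T'.col = T.col := by
  have hsub : μ.cells ⊆ Finset.univ.image fun k => (f k, T.col k) := by
    rw [← Finset.sdiff_eq_empty_iff_subset, ← Finset.card_eq_zero]
    have := T.sum_row_add_card_sdiff_le hf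
    omega
  have hcard : μ.cells.card = n := by
    simpa using Fintype.card_congr T
  have heq := Finset.eq_of_subset_of_card_le hsub
    (by rw [Finset.card_image_of_injective _ hf, hcard, Finset.card_univ, Fintype.card_fin])
  let e : Fin n ≃ {c : ℕ × ℕ // c ∈ μ.cells} := Equiv.ofBijective
    (fun k => ⟨(f k, T.col k), heq ▸ Finset.mem_image_of_mem _ (Finset.mem_univ k)⟩)
    ((Fintype.bijective_iff_injective_and_card _).2
      ⟨fun _ _ h => hf (congrArg Subtype.val h), by simp [hcard]⟩)
  exact ⟨e.symm, rfl, rfl⟩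

theorem tabloid_surjective (T : Tableau n μ) :
    Function.Surjective (tabloid : Tableau n μ → Tabloid n μ) := by
  intro r
  let e (i : ℕ) : {k // r.1 k = i} ≃ {k // T.row k = i} := Fintype.equivOfCardEq (by
    rw [Fintype.card_subtype, Fintype.card_subtype, r.2, T.card_row_eq])
  exact ⟨T.act (Equiv.ofFiberEquiv e).symm, Subtype.ext (funext (Equiv.ofFiberEquiv_map e))⟩

theorem exists_mem_columnStabilizer (T : Tableau n μ) (r : Tabloid n μ)
    (h : Function.Injective fun k => (r.1 k, T.col k)) :
    ∃ σ ∈ T.columnStabilizer, (T.act σ).tabloid = r := by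
  obtain ⟨S, rfl⟩ := T.tabloid_surjective r
  obtain ⟨T', hrow, hcol⟩ := T.exists_row_eq_col_eq h (S.sum_row_eq T).le
  obtain ⟨σ, rfl⟩ := T.exists_act_eq T'
  refine ⟨σ, mem_columnStabilizer.2 fun k => ?_, Subtype.ext hrow⟩
  simpa [act, col] using congrFun hcol.symm (σ k)

end Tableau

end Tableaux

/-- The sign character with complex values. -/
def signHom (n : ℕ) : Perm (Fin n) →* ℂ :=
  ((Int.castRingHom ℂ : ℤ →* ℂ).comp (Units.coeHom ℤ)).comp Perm.sign

section ColumnSums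

variable {n : ℕ} {μ : YoungDiagram}

theorem signHom_apply (σ : Perm (Fin n)) : signHom n σ = ((Perm.sign σ : ℤ) : ℂ) := rfl

theorem signHom_mul_self (σ : Perm (Fin n)) : signHom n σ * signHom n σ = 1 := by
  rw [← map_mul, signHom_apply]
  simp

theorem signHom_swap {a b : Fin n} (hab : a ≠ b) : signHom n (swap a b) = -1 := by
  simp [signHom_apply, Perm.sign_swap hab]

theorem smul_tabloid_apply (σ : Perm (Fin n)) (r : Tabloid n μ) (k : Fin n) :
    (σ • r).1 k = r.1 (σ⁻¹ k) := rfl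

theorem swap_smul_tabloid {r : Tabloid n μ} {a b : Fin n} (h : r.1 a = r.1 b) :
    swap a b • r = r :=
  Subtype.ext (funext fun k => by
    rw [smul_tabloid_apply, swap_inv]
    exact Equiv.apply_swap_eq_self h k)

theorem tabloidRep_single (σ : Perm (Fin n)) (r : Tabloid n μ) (c : ℂ) :
    tabloidRep n μ σ (MonoidAlgebra.single r c) = MonoidAlgebra.single (σ • r) c :=
  ofMulAction_single ..

theorem coeff_eq_zero_of_smul_eq {v : MonoidAlgebra ℂ (Tabloid n μ)} {σ : Perm (Fin n)}
    (hv : tabloidRep n μ σ v = -v) {r : Tabloid n μ} (hr : σ • r = r) : v.coeff r = 0 := by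
  have h := congrArg (fun w => w.coeff (σ • r)) hv
  rw [hr, tabloidRep, coeff_ofMulAction, inv_smul_eq_iff.2 hr.symm] at h
  exact self_eq_neg.1 h

namespace Tableau

/-- The sum of the column stabilizer of `T`, weighted by a linear character `χ` and acting on
`M^μ`: for `χ = sgn` it is the column antisymmetrizer `κ_T`, and `e_T = κ_T {T}`. -/
def columnSum (T : Tableau n μ) (χ : Perm (Fin n) →* ℂ) :
    Module.End ℂ (MonoidAlgebra ℂ (Tabloid n μ)) :=
  ∑ σ ∈ T.columnStabilizer, χ σ • tabloidRep n μ σ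

variable (T : Tableau n μ)

theorem columnSum_apply (χ : Perm (Fin n) →* ℂ) (v : MonoidAlgebra ℂ (Tabloid n μ)) :
    T.columnSum χ v = ∑ σ ∈ T.columnStabilizer, χ σ • tabloidRep n μ σ v := by
  simp [columnSum, LinearMap.sum_apply]

theorem columnSum_sign_single :
    T.columnSum (signHom n) (MonoidAlgebra.single T.tabloid 1) = T.polytabloid := by
  simp only [columnSum_apply, tabloidRep_single, polytabloid, tabloid_act, signHom_apply]

theorem swap_mem_columnStabilizer {a b : Fin n} (h : T.col a = T.col b) :
    swap a b ∈ T.columnStabilizer :=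
  mem_columnStabilizer.2 (Equiv.apply_swap_eq_self h)

theorem columnSum_eq_smul {χ : Perm (Fin n) →* ℂ} {v : MonoidAlgebra ℂ (Tabloid n μ)}
    (hv : ∀ σ ∈ T.columnStabilizer, χ σ • tabloidRep n μ σ v = v) :
    T.columnSum χ v = (T.columnStabilizer.card : ℂ) • v := by
  rw [columnSum_apply, Finset.sum_congr rfl hv, Finset.sum_const, Nat.cast_smul_eq_nsmul]

theorem sum_columnStabilizer_mul_right {M : Type*} [AddCommMonoid M] {τ : Perm (Fin n)}
    (hτ : τ ∈ T.columnStabilizer) (f : Perm (Fin n) → M) :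
    ∑ σ ∈ T.columnStabilizer, f (σ * τ) = ∑ σ ∈ T.columnStabilizer, f σ := by
  refine Finset.sum_equiv (Equiv.mulRight τ) (fun σ => ?_) fun σ _ => rfl
  simp only [mem_columnStabilizer, coe_mulRight, Perm.mul_apply] at hτ ⊢
  exact ⟨fun h k => (h _).trans (hτ k), fun h k => by
    simpa using (h (τ⁻¹ k)).trans (by simpa using (hτ (τ⁻¹ k)).symm)⟩

theorem columnSum_apply_apply (χ : Perm (Fin n) →* ℂ) {τ : Perm (Fin n)}
    (hτ : τ ∈ T.columnStabilizer) (v : MonoidAlgebra ℂ (Tabloid n μ)) :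
    T.columnSum χ (χ τ • tabloidRep n μ τ v) = T.columnSum χ v := by
  rw [columnSum_apply, columnSum_apply]
  refine (Finset.sum_congr rfl fun σ _ => ?_).trans
    (T.sum_columnStabilizer_mul_right hτ fun σ => χ σ • tabloidRep n μ σ v)
  rw [map_smul, smul_smul, map_mul, map_mul]
  rfl

theorem columnSum_eq_zero {χ : Perm (Fin n) →* ℂ} {τ : Perm (Fin n)}
    (hτ : τ ∈ T.columnStabilizer) {v : MonoidAlgebra ℂ (Tabloid n μ)}
    (hv : χ τ • tabloidRep n μ τ v = -v) : T.columnSum χ v = 0 := by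
  have h := T.columnSum_apply_apply χ hτ v
  rw [hv, map_neg] at h
  have : IsAddTorsionFree (MonoidAlgebra ℂ (Tabloid n μ)) := .of_isTorsionFree ℂ _
  exact self_eq_neg.1 h.symm

theorem columnStabilizer_act {T : Tableau n μ} {τ : Perm (Fin n)} (hτ : τ ∈ T.columnStabilizer) :
    (T.act τ).columnStabilizer = T.columnStabilizer := by
  have hcol : (T.act τ).col = T.col := funext fun k => by
    simpa [act, col] using (mem_columnStabilizer.1 hτ (τ⁻¹ k)).symm
  ext σ
  rw [mem_columnStabilizer, mem_columnStabilizer, hcol]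

theorem sign_smul_tabloidRep_polytabloid {T : Tableau n μ} {τ : Perm (Fin n)}
    (hτ : τ ∈ T.columnStabilizer) :
    signHom n τ • tabloidRep n μ τ T.polytabloid = T.polytabloid := by
  have hact : (T.act τ).polytabloid = T.columnSum (signHom n)
      (tabloidRep n μ τ (MonoidAlgebra.single T.tabloid 1)) := by
    rw [← columnSum_sign_single, columnSum, columnStabilizer_act hτ, tabloidRep_single,
      tabloid_act, columnSum]
  rw [tabloidRep_polytabloid, hact, ← map_smul, T.columnSum_apply_apply _ hτ,
    columnSum_sign_single]

theorem columnSum_sign_single_mem_span (r : Tabloid n μ) (c : ℂ) :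
    T.columnSum (signHom n) (MonoidAlgebra.single r c) ∈ Submodule.span ℂ {T.polytabloid} := by
  by_cases h : Function.Injective fun k => (r.1 k, T.col k)
  · obtain ⟨σ, hσ, rfl⟩ := T.exists_mem_columnStabilizer r h
    refine Submodule.mem_span_singleton.2 ⟨c * signHom n σ, ?_⟩
    rw [← columnSum_sign_single, ← T.columnSum_apply_apply _ hσ, ← map_smul, smul_smul, mul_assoc,
      signHom_mul_self, tabloidRep_single, tabloid_act, MonoidAlgebra.smul_single, mul_one,
      smul_eq_mul, mul_one]
  · obtain ⟨a, b, hab, hne⟩ := Function.not_injective_iff.1 h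
    rw [T.columnSum_eq_zero (T.swap_mem_columnStabilizer (Prod.ext_iff.1 hab).2)]
    · exact zero_mem _
    · rw [tabloidRep_single, swap_smul_tabloid (congrArg Prod.fst hab), signHom_swap hne,
        neg_one_smul]

theorem columnSum_sign_mem_span (v : MonoidAlgebra ℂ (Tabloid n μ)) :
    T.columnSum (signHom n) v ∈ Submodule.span ℂ {T.polytabloid} := by
  induction v using MonoidAlgebra.induction_linear with
  | zero => simp
  | add v w hv hw => rw [map_add]; exact add_mem hv hw
  | single r c => exact T.columnSum_sign_single_mem_span r c

theorem card_columnStabilizer_ne_zero : (T.columnStabilizer.card : ℂ) ≠ 0 :=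
  Nat.cast_ne_zero.2 (Finset.card_ne_zero_of_mem
    (mem_columnStabilizer.2 fun _ => rfl : 1 ∈ T.columnStabilizer))

theorem coeff_polytabloid_self : T.polytabloid.coeff T.tabloid = 1 := by
  classical
  simp only [polytabloid, MonoidAlgebra.coeff_sum, Finsupp.finsetSum_apply,
    MonoidAlgebra.coeff_smul_apply, MonoidAlgebra.coeff_single, Finsupp.single_apply]
  rw [Finset.sum_eq_single_of_mem 1 (mem_columnStabilizer.2 fun _ => rfl)]
  · simp [tabloid_act]
  · intro σ hσ hne
    rw [if_neg, smul_zero]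
    refine fun h => hne (Perm.ext fun k => T.row_col_injective (Prod.ext ?_ ?_))
    · simpa [tabloid_act, smul_tabloid_apply, tabloid_apply] using
        (congrFun (congrArg Subtype.val h) (σ k)).symm
    · exact mem_columnStabilizer.1 hσ k

theorem polytabloid_ne_zero : T.polytabloid ≠ 0 := fun h => by
  simpa [h] using T.coeff_polytabloid_self

end Tableau

end ColumnSums

section Averaging

variable {k G V : Type*} [Group G] [AddCommGroup V]

section CommRing

variable [CommRing k] [Module k V]

/-- The sum of the conjugates of `f` weighted by a linear character `χ`: the (unnormalized)
projection onto the endomorphisms that intertwine `ρ` with its twist by `χ`. -/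
def twistedSum [Fintype G] (ρ : Representation k G V) (χ : G →* k) (f : Module.End k V) :
    Module.End k V :=
  ∑ g, χ g • (ρ g * f * ρ g⁻¹)

theorem twistedSum_apply [Fintype G] (ρ : Representation k G V) (χ : G →* k) (f : Module.End k V)
    (v : V) : twistedSum ρ χ f v = ∑ g, χ g • ρ g (f (ρ g⁻¹ v)) := by
  simp [twistedSum, LinearMap.sum_apply]

theorem smul_apply_twistedSum [Fintype G] (ρ : Representation k G V) (χ : G →* k)
    (f : Module.End k V) (h : G) (v : V) :
    χ h • ρ h (twistedSum ρ χ f v) = twistedSum ρ χ f (ρ h v) := by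
  simp only [twistedSum_apply, map_sum, Finset.smul_sum]
  refine Fintype.sum_equiv (Equiv.mulLeft h) _ _ fun g => ?_
  rw [coe_mulLeft, mul_inv_rev, map_smul, smul_smul, ← map_mul, map_mul ρ h g, map_mul ρ g⁻¹ h⁻¹,
    Module.End.mul_apply, Module.End.mul_apply, inv_self_apply]

end CommRing

section Field

variable [Field k] [Module k V]

theorem exists_equivariant_isProj [Finite G] [NeZero (Nat.card G : k)] {ρ : Representation k G V}
    (U : Subrepresentation ρ) :
    ∃ p : Module.End k V, LinearMap.IsProj U.toSubmodule p ∧ ∀ g, Commute p (ρ g) := by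
  obtain ⟨W, hW⟩ := exists_isCompl U
  have hc : IsCompl U.toSubmodule W.toSubmodule := by
    refine IsCompl.of_eq ?_ ?_
    · rw [← Subrepresentation.toSubmodule_inf, hW.inf_eq_bot]; rfl
    · rw [← Subrepresentation.toSubmodule_sup, hW.sup_eq_top]; rfl
  refine ⟨U.toSubmodule.projection W.toSubmodule hc,
    ⟨Submodule.projection_apply_mem hc, fun _ => Submodule.projection_apply_of_mem_left hc⟩,
    fun g => (LinearMap.IsIdempotentElem.commute_iff (Submodule.isIdempotentElem_projection hc)).2
      ⟨?_, ?_⟩⟩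
  · rw [Submodule.range_projection]
    exact fun _ hv => U.apply_mem_toSubmodule g hv
  · rw [Submodule.ker_projection]
    exact fun _ hv => W.apply_mem_toSubmodule g hv

theorem isIrreducible_of_forall_scalar [Finite G] [NeZero (Nat.card G : k)]
    {ρ : Representation k G V} {S : Subrepresentation ρ} [Nontrivial S.toSubmodule]
    (h : ∀ p : Module.End k V, (∀ g, Commute p (ρ g)) → (∀ v, p v ∈ S.toSubmodule) →
      ∃ c : k, ∀ v ∈ S.toSubmodule, p v = c • v) :
    S.toRepresentation.IsIrreducible := by
  have : Nontrivial (Subrepresentation S.toRepresentation) :=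
    ⟨⊥, ⊤, fun h => bot_ne_top (congrArg Subrepresentation.toSubmodule h)⟩
  refine ⟨fun U => ?_⟩
  let U' : Subrepresentation ρ :=
    { toSubmodule := U.toSubmodule.map S.toSubmodule.subtype
      apply_mem_toSubmodule := by
        rintro g _ ⟨u, hu, rfl⟩
        exact ⟨_, U.apply_mem_toSubmodule g hu, rfl⟩ }
  obtain ⟨p, hp, hcomm⟩ := exists_equivariant_isProj U'
  have hpU (v : V) : ∃ u ∈ U.toSubmodule, (u : V) = p v := hp.map_mem v
  obtain ⟨c, hc⟩ := h p hcomm fun v => by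
    obtain ⟨u, -, hu⟩ := hpU v
    exact hu ▸ u.2
  rcases eq_or_ne c 0 with rfl | hc0
  · left
    refine Subrepresentation.toSubmodule_injective ((Submodule.eq_bot_iff _).2 fun u hu => ?_)
    have := hp.map_id u ⟨u, hu, rfl⟩
    rw [hc u u.2, zero_smul] at this
    exact Subtype.ext this.symm
  · right
    refine Subrepresentation.toSubmodule_injective (Submodule.eq_top_iff'.2 fun v => ?_)
    obtain ⟨u, hu, huv⟩ := hpU v
    rw [hc v v.2] at huv
    exact (Submodule.smul_mem_iff _ hc0).1 ((Subtype.ext huv : u = c • v) ▸ hu)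

end Field

end Averaging

section Irreducibility

variable {n : ℕ} {μ : YoungDiagram}

theorem polytabloid_mem_specht (T : Tableau n μ) : T.polytabloid ∈ (specht n μ).toSubmodule :=
  Submodule.subset_span ⟨T, rfl⟩

theorem specht_le_iff {N : Submodule ℂ (MonoidAlgebra ℂ (Tabloid n μ))} :
    (specht n μ).toSubmodule ≤ N ↔ ∀ T : Tableau n μ, T.polytabloid ∈ N :=
  Submodule.span_le.trans Set.range_subset_iff

theorem nontrivial_specht (T : Tableau n μ) : Nontrivial (specht n μ).toSubmodule :=
  ⟨⟨⟨T.polytabloid, polytabloid_mem_specht T⟩, 0, fun h =>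
    T.polytabloid_ne_zero (congrArg Subtype.val h)⟩⟩

/-- James's submodule argument: `f e_T` is a multiple of `κ_T (f e_T)`, hence of `e_T`. -/
theorem exists_forall_mem_specht_eq_smul [hT : Nonempty (Tableau n μ)]
    {f : Module.End ℂ (MonoidAlgebra ℂ (Tabloid n μ))} (hf : ∀ σ, Commute f (tabloidRep n μ σ)) :
    ∃ c : ℂ, ∀ v ∈ (specht n μ).toSubmodule, f v = c • v := by
  obtain ⟨T⟩ := hT
  have hfσ (σ : Perm (Fin n)) (v) : f (tabloidRep n μ σ v) = tabloidRep n μ σ (f v) :=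
    LinearMap.congr_fun (hf σ) v
  have hκ : T.columnSum (signHom n) (f T.polytabloid) =
      (T.columnStabilizer.card : ℂ) • f T.polytabloid :=
    T.columnSum_eq_smul fun σ hσ => by
      rw [← hfσ, ← map_smul, Tableau.sign_smul_tabloidRep_polytabloid hσ]
  obtain ⟨c, hc⟩ : ∃ c : ℂ, c • T.polytabloid = f T.polytabloid := by
    rw [← Submodule.mem_span_singleton,
      ← Submodule.smul_mem_iff _ T.card_columnStabilizer_ne_zero, ← hκ]
    exact T.columnSum_sign_mem_span _
  suffices (specht n μ).toSubmodule ≤ LinearMap.eqLocus f (c • LinearMap.id) from ⟨c, this⟩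
  refine specht_le_iff.2 fun T' => ?_
  obtain ⟨σ, rfl⟩ := T.exists_act_eq T'
  rw [LinearMap.mem_eqLocus, LinearMap.smul_apply, LinearMap.id_apply,
    ← tabloidRep_polytabloid, hfσ, ← hc, map_smul]

theorem exists_injective_col_col {T : Tableau n μ} {v : MonoidAlgebra ℂ (Tabloid n μ)}
    (hv : v ∈ (specht n μ).toSubmodule) (hv0 : v ≠ 0)
    (hinv : ∀ σ ∈ T.columnStabilizer, tabloidRep n μ σ v = v) :
    ∃ S : Tableau n μ, Function.Injective fun k => (S.col k, T.col k) := by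
  by_contra! hnone
  have hker : (specht n μ).toSubmodule ≤ LinearMap.ker (T.columnSum 1) :=
    specht_le_iff.2 fun S => by
      obtain ⟨a, b, hab, hne⟩ := Function.not_injective_iff.1 (hnone S)
      have hS := Tableau.sign_smul_tabloidRep_polytabloid
        (S.swap_mem_columnStabilizer (Prod.ext_iff.1 hab).1)
      rw [signHom_swap hne, neg_one_smul, neg_eq_iff_eq_neg] at hS
      exact T.columnSum_eq_zero (T.swap_mem_columnStabilizer (Prod.ext_iff.1 hab).2)
        (by rwa [MonoidHom.one_apply, one_smul])
  have hsum : T.columnSum 1 v = (T.columnStabilizer.card : ℂ) • v :=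
    T.columnSum_eq_smul fun σ hσ => by rw [MonoidHom.one_apply, one_smul, hinv σ hσ]
  exact smul_ne_zero T.card_columnStabilizer_ne_zero hv0 (hsum.symm.trans (hker hv))

theorem exists_injective_row_row {T : Tableau n μ} {v : MonoidAlgebra ℂ (Tabloid n μ)}
    (hv0 : v ≠ 0)
    (halt : ∀ a b, a ≠ b → T.row a = T.row b → tabloidRep n μ (swap a b) v = -v) :
    ∃ r : Tabloid n μ, Function.Injective fun k => (r.1 k, T.row k) := by
  obtain ⟨r, hr⟩ : ∃ r, v.coeff r ≠ 0 := by
    by_contra! h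
    exact hv0 (MonoidAlgebra.ext (Finsupp.ext h))
  refine ⟨r, fun a b hab => by_contra fun hne => hr ?_⟩
  exact coeff_eq_zero_of_smul_eq (halt a b hne (Prod.ext_iff.1 hab).2)
    (swap_smul_tabloid (Prod.ext_iff.1 hab).1)

theorem transpose_eq_of_injective_col_col {S T : Tableau n μ}
    (hcol : Function.Injective fun k => (S.col k, T.col k))
    (hsum : ∑ k, T.col k ≤ ∑ k, T.row k) : μ.transpose = μ := by
  obtain ⟨T', hrow, -⟩ := T.exists_row_eq_col_eq hcol ((S.sum_col_eq T).trans_le hsum)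
  ext ⟨i, j⟩
  rw [YoungDiagram.mem_cells, YoungDiagram.mem_cells, YoungDiagram.mem_iff_lt_rowLen,
    YoungDiagram.mem_iff_lt_rowLen, ← S.transpose.card_row_eq, ← T'.card_row_eq, hrow]
  rfl

theorem sum_col_le_sum_row_of_injective_row_row {T : Tableau n μ} {r : Tabloid n μ}
    (hrow : Function.Injective fun k => (r.1 k, T.row k)) : ∑ k, T.col k ≤ ∑ k, T.row k := by
  obtain ⟨S, rfl⟩ := T.tabloid_surjective r
  exact (T.transpose.sum_row_le hrow).trans (S.sum_row_eq T).le

theorem eq_zero_of_sign_twisted (hμ : μ.transpose ≠ μ)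
    {f : Module.End ℂ (MonoidAlgebra ℂ (Tabloid n μ))}
    (hf : ∀ σ v, signHom n σ • tabloidRep n μ σ (f v) = f (tabloidRep n μ σ v))
    (hS : ∀ v, f v ∈ (specht n μ).toSubmodule) {v : MonoidAlgebra ℂ (Tabloid n μ)}
    (hv : v ∈ (specht n μ).toSubmodule) : f v = 0 := by
  suffices (specht n μ).toSubmodule ≤ LinearMap.ker f from this hv
  refine specht_le_iff.2 fun T => by_contra fun hT => hμ ?_
  obtain ⟨S, hcol⟩ := exists_injective_col_col (T := T) (hS _) hT fun σ hσ => by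
    conv_rhs => rw [← Tableau.sign_smul_tabloidRep_polytabloid hσ, map_smul, ← hf, smul_smul,
      signHom_mul_self, one_smul]
  obtain ⟨T', hT'⟩ : ∃ T' : Tableau n μ, f (MonoidAlgebra.single T'.tabloid 1) ≠ 0 := by
    by_contra! h0
    exact hT (by simp only [LinearMap.mem_ker, Tableau.polytabloid, map_sum, map_smul, h0,
      smul_zero, Finset.sum_const_zero])
  obtain ⟨r, hrow⟩ := exists_injective_row_row (T := T') hT' fun a b hne hab => by
    rw [eq_neg_iff_add_eq_zero, ← neg_eq_iff_add_eq_zero, ← neg_one_smul ℂ, ← signHom_swap hne, hf,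
      tabloidRep_single, swap_smul_tabloid hab]
  refine transpose_eq_of_injective_col_col hcol ?_
  rw [T.sum_col_eq T', T.sum_row_eq T']
  exact sum_col_le_sum_row_of_injective_row_row hrow

theorem twistedSum_one_add_twistedSum_sign {V : Type*} [AddCommGroup V] [Module ℂ V]
    (ρ : Representation ℂ (Perm (Fin n)) V) {f : Module.End ℂ V}
    (hf : ∀ σ ∈ alternatingGroup (Fin n), Commute f (ρ σ)) :
    twistedSum ρ 1 f + twistedSum ρ (signHom n) f =
      (2 * Nat.card (alternatingGroup (Fin n)) : ℂ) • f := by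
  classical
  have hterm (σ : Perm (Fin n)) : (1 : Perm (Fin n) →* ℂ) σ • (ρ σ * f * ρ σ⁻¹) +
      signHom n σ • (ρ σ * f * ρ σ⁻¹) =
        if σ ∈ alternatingGroup (Fin n) then (2 : ℂ) • f else 0 := by
    rw [MonoidHom.one_apply, ← add_smul, signHom_apply]
    split_ifs with hσ
    · rw [← (hf σ hσ).eq, mul_assoc, ← map_mul, mul_inv_cancel, map_one, mul_one,
        Perm.mem_alternatingGroup.1 hσ]
      norm_num
    · rw [(Int.units_eq_one_or _).resolve_left (mt Perm.mem_alternatingGroup.2 hσ)]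
      simp
  rw [twistedSum, twistedSum, ← Finset.sum_add_distrib, Finset.sum_congr rfl fun σ _ => hterm σ,
    ← Finset.sum_filter, Finset.sum_const, ← Fintype.card_subtype, ← Nat.card_eq_fintype_card,
    mul_comm, mul_smul, Nat.cast_smul_eq_nsmul]

theorem altSpecht_isIrreducible [hT : Nonempty (Tableau n μ)] (hμ : μ.transpose ≠ μ) :
    (altSpecht n μ).IsIrreducible := by
  let S : Subrepresentation (resAlt (tabloidRep n μ)) :=
    ⟨(specht n μ).toSubmodule, fun g => (specht n μ).apply_mem_toSubmodule g⟩
  have : Nontrivial S.toSubmodule := nontrivial_specht hT.some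
  refine isIrreducible_of_forall_scalar (S := S) fun p hp hpS => ?_
  obtain ⟨c, hc⟩ := exists_forall_mem_specht_eq_smul (f := twistedSum (tabloidRep n μ) 1 p)
    fun σ => LinearMap.ext fun v => by
      simpa using (smul_apply_twistedSum (tabloidRep n μ) 1 p σ v).symm
  have hsign := fun v => eq_zero_of_sign_twisted (v := v) hμ
    (smul_apply_twistedSum (tabloidRep n μ) (signHom n) p) fun w => by
      rw [twistedSum_apply]
      exact sum_mem fun σ _ => Submodule.smul_mem _ _ ((specht n μ).apply_mem_toSubmodule σ (hpS _))
  set N : ℂ := 2 * Nat.card (alternatingGroup (Fin n))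
  have hN : N ≠ 0 := mul_ne_zero two_ne_zero (Nat.cast_ne_zero.2 Nat.card_pos.ne')
  refine ⟨N⁻¹ * c, fun v hv => ?_⟩
  have hsum := LinearMap.congr_fun
    (twistedSum_one_add_twistedSum_sign (tabloidRep n μ) fun σ hσ => hp ⟨σ, hσ⟩) v
  rw [LinearMap.add_apply, hc v hv, hsign v hv, add_zero, LinearMap.smul_apply] at hsum
  rw [mul_smul, hsum, inv_smul_smul₀ hN]

end Irreducibility

section LiftOfMulAction

variable {k G W X : Type*} [CommRing k] [Group G] [AddCommGroup W] [Module k W] [MulAction G X]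

/-- The linear extension to the permutation representation of an equivariant map on a `G`-set. -/
def liftOfMulAction (τ : Representation k G W) (φ : X → W)
    (hφ : ∀ g x, φ (g • x) = τ g (φ x)) : IntertwiningMap (ofMulAction k G X) τ where
  toLinearMap := (MonoidAlgebra.basis X k).constr k φ
  isIntertwining' g := (MonoidAlgebra.basis X k).ext fun x => by
    rw [LinearMap.comp_apply, LinearMap.comp_apply, Module.Basis.constr_basis, ← hφ,
      MonoidAlgebra.basis_apply, ofMulAction_single, ← MonoidAlgebra.basis_apply,
      Module.Basis.constr_basis]

theorem liftOfMulAction_single (τ : Representation k G W) (φ : X → W)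
    (hφ : ∀ g x, φ (g • x) = τ g (φ x)) (x : X) :
    liftOfMulAction τ φ hφ (MonoidAlgebra.single x 1) = φ x := by
  rw [← MonoidAlgebra.basis_apply]
  exact (MonoidAlgebra.basis X k).constr_basis k φ x

end LiftOfMulAction

section Characters

variable {k G V W : Type*} [Field k] [Group G] [AddCommGroup V] [Module k V]
  [AddCommGroup W] [Module k W]

theorem character_prod [FiniteDimensional k V] [FiniteDimensional k W]
    (ρ : Representation k G V) (τ : Representation k G W) :
    (ρ.prod τ).character = ρ.character + τ.character :=
  funext fun g => LinearMap.trace_prodMap' (ρ g) (τ g)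

theorem character_eq_add_of_surjective [FiniteDimensional k V] [FiniteDimensional k W]
    [Finite G] [NeZero (Nat.card G : k)] {ρ : Representation k G V} {τ : Representation k G W}
    {q : IntertwiningMap ρ τ} (hq : Function.Surjective q) :
    ρ.character = q.ker.toRepresentation.character + τ.character := by
  obtain ⟨p, hp, hcomm⟩ := exists_equivariant_isProj q.ker
  have hcompl : IsCompl (LinearMap.ker hp.codRestrict) (LinearMap.ker q.toLinearMap) := by
    rw [hp.codRestrict_ker]
    exact hp.isCompl.symm
  let e := LinearMap.equivProdOfSurjectiveOfIsCompl hp.codRestrict q.toLinearMap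
    (LinearMap.range_eq_top.2 fun u => ⟨u, hp.codRestrict_apply_cod u⟩)
    (LinearMap.range_eq_top.2 hq) hcompl
  have he (g : G) (v : V) : e (ρ g v) = (q.ker.toRepresentation.prod τ) g (e v) :=
    Prod.ext (Subtype.ext (LinearMap.congr_fun (hcomm g) v)) (q.isIntertwining ρ τ g v)
  rw [← character_prod]
  exact char_iso (.mk e fun g => LinearMap.ext (he g))

theorem character_ofMulAction {X : Type*} [MulAction G X] [Fintype X] [DecidableEq X] (g : G) :
    (ofMulAction k G X).character g = (Finset.univ.filter fun x : X => g • x = x).card := by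
  rw [character, LinearMap.trace_eq_matrix_trace k (MonoidAlgebra.basis X k), Matrix.trace,
    Finset.natCast_card_filter]
  refine Finset.sum_congr rfl fun x _ => ?_
  rw [Matrix.diag_apply, LinearMap.toMatrix_apply, MonoidAlgebra.basis_apply, ofMulAction_single,
    ← MonoidAlgebra.basis_apply, Module.Basis.repr_self, Finsupp.single_apply]

end Characters

section Tabloids

variable {n : ℕ} {μ : YoungDiagram}

theorem Tabloid.rowLen_pos (r : Tabloid n μ) (k : Fin n) : 0 < μ.rowLen (r.1 k) := by
  rw [← r.2, Finset.card_pos]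
  exact ⟨k, by simp⟩

instance : Finite (Tabloid n μ) :=
  Finite.of_injective
    (fun r k => (⟨r.1 k, YoungDiagram.mem_iff_lt_colLen.1
      (YoungDiagram.mem_iff_lt_rowLen.2 (r.rowLen_pos k))⟩ : Fin (μ.colLen 0)))
    fun _ _ h => Subtype.ext (funext fun k => congrArg Fin.val (congrFun h k))

instance {X : Type*} [Finite X] : FiniteDimensional ℂ (MonoidAlgebra ℂ X) :=
  .of_basis (MonoidAlgebra.basis X ℂ)

theorem character_tabloidRep_eq_add {W : Type*} [AddCommGroup W] [Module ℂ W]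
    [FiniteDimensional ℂ W] {τ : Representation ℂ (Perm (Fin n)) W}
    {q : IntertwiningMap (tabloidRep n μ) τ} (hq : Function.Surjective q)
    (h0 : ∀ T : Tableau n μ, q T.polytabloid = 0)
    (hsep : ∀ f : MonoidAlgebra ℂ (Tabloid n μ) →ₗ[ℂ] ℂ, (∀ T : Tableau n μ, f T.polytabloid = 0) →
      ∃ ψ : W →ₗ[ℂ] ℂ, ∀ r, f (.single r 1) = ψ (q (.single r 1))) :
    (tabloidRep n μ).character = (specht n μ).toRepresentation.character + τ.character := by
  have hker : q.ker = specht n μ := by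
    refine Subrepresentation.toSubmodule_injective (le_antisymm (fun v hv => ?_)
      (specht_le_iff.2 h0))
    by_contra hvS
    obtain ⟨f, hfv, hf⟩ := Submodule.exists_le_ker_of_notMem hvS
    obtain ⟨ψ, hψ⟩ := hsep f (specht_le_iff.1 hf)
    have hfac : f = ψ ∘ₗ q.toLinearMap := (MonoidAlgebra.basis _ ℂ).ext hψ
    have hqv : q.toLinearMap v = 0 := hv
    exact hfv (by rw [hfac, LinearMap.comp_apply, hqv, map_zero])
  rw [character_eq_add_of_surjective hq, hker]

end Tabloids

section CoreBoxes

variable {n m : ℕ} {μ : YoungDiagram}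

/-- The boxes `c i` are boxes of `μ`, and among them are all the boxes that share their column with
another box; only these matter for the polytabloids of shape `μ`. -/
structure IsColumnCore (μ : YoungDiagram) (c : Fin m → ℕ × ℕ) : Prop where
  injective : Function.Injective c
  mem (i : Fin m) : c i ∈ μ
  eq_of_snd_eq {b b' : ℕ × ℕ} (hb : b ∈ μ) (hb' : b' ∈ μ) (h : b.2 = b'.2)
    (hbc : b ∉ Set.range c) : b = b'

namespace IsColumnCore

variable {c : Fin m → ℕ × ℕ} (hc : IsColumnCore μ c)

/-- The letters of a tableau in the core boxes. -/
def letters (T : Tableau n μ) : Fin m ↪ Fin n where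
  toFun i := T ⟨c i, hc.mem i⟩
  inj' _ _ h := hc.injective (congrArg Subtype.val (T.injective h))

theorem symm_letters (T : Tableau n μ) (i : Fin m) : (T.symm (hc.letters T i)).1 = c i :=
  congrArg Subtype.val (T.symm_apply_apply _)

theorem row_letters (T : Tableau n μ) (i : Fin m) : T.row (hc.letters T i) = (c i).1 :=
  congrArg Prod.fst (hc.symm_letters T i)

theorem col_letters (T : Tableau n μ) (i : Fin m) : T.col (hc.letters T i) = (c i).2 :=
  congrArg Prod.snd (hc.symm_letters T i)

theorem letters_surjective (T : Tableau n μ) :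
    Function.Surjective (hc.letters : Tableau n μ → Fin m ↪ Fin n) := by
  intro x
  obtain ⟨σ, hσ⟩ := Perm.exists_extending_pair (hc.letters T) x (hc.letters T).injective x.injective
  exact ⟨T.act σ, DFunLike.ext _ _ hσ⟩

theorem eq_of_col_eq (T : Tableau n μ) {k k' : Fin n} (hk : k ∉ Set.range (hc.letters T))
    (h : T.col k = T.col k') : k = k' := by
  refine T.symm.injective (Subtype.ext (hc.eq_of_snd_eq (T.symm k).2 (T.symm k').2 h ?_))
  rintro ⟨i, hi⟩
  exact hk ⟨i, T.symm.injective (Subtype.ext ((hc.symm_letters T i).trans hi))⟩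

theorem exists_viaFintypeEmbedding_eq {T : Tableau n μ} {σ : Perm (Fin n)}
    (hσ : σ ∈ T.columnStabilizer) :
    ∃ τ : Perm (Fin m), τ.viaFintypeEmbedding (hc.letters T) = σ := by
  have hfix (k) (hk : k ∉ Set.range (hc.letters T)) : σ k = k :=
    (hc.eq_of_col_eq T hk (Tableau.mem_columnStabilizer.1 hσ k).symm).symm
  have hmaps (i : Fin m) : ∃ j, hc.letters T j = σ (hc.letters T i) := by
    by_contra h
    exact h ⟨i, (σ.injective (hfix _ h)).symm⟩
  choose τ hτ using hmaps
  have hinj : Function.Injective τ := fun i j h => by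
    apply (hc.letters T).injective
    rw [← σ.injective.eq_iff, ← hτ, ← hτ, h]
  refine ⟨Equiv.ofBijective τ (Finite.injective_iff_bijective.1 hinj), Perm.ext fun k => ?_⟩
  by_cases hk : k ∈ Set.range (hc.letters T)
  · obtain ⟨i, rfl⟩ := hk
    rw [Perm.viaFintypeEmbedding_apply_image, Equiv.ofBijective_apply, hτ]
  · rw [Perm.viaFintypeEmbedding_apply_notMem_range _ _ hk, hfix k hk]

theorem viaFintypeEmbedding_mem_columnStabilizer {T : Tableau n μ} {τ : Perm (Fin m)} :
    τ.viaFintypeEmbedding (hc.letters T) ∈ T.columnStabilizer ↔ ∀ i, (c (τ i)).2 = (c i).2 := by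
  simp only [Tableau.mem_columnStabilizer, ← hc.col_letters T]
  refine ⟨fun h i => by simpa using h (hc.letters T i), fun h k => ?_⟩
  by_cases hk : k ∈ Set.range (hc.letters T)
  · obtain ⟨i, rfl⟩ := hk
    rw [Perm.viaFintypeEmbedding_apply_image, h]
  · rw [Perm.viaFintypeEmbedding_apply_notMem_range _ _ hk]

theorem polytabloid_eq_sum (T : Tableau n μ) :
    T.polytabloid = ∑ τ : Perm (Fin m) with ∀ i, (c (τ i)).2 = (c i).2, signHom m τ •
      MonoidAlgebra.single (T.act (τ.viaFintypeEmbedding (hc.letters T))).tabloid 1 := by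
  refine (Finset.sum_bij (fun τ _ => τ.viaFintypeEmbedding (hc.letters T)) ?_ ?_ ?_ ?_).symm
  · intro τ hτ
    simpa [hc.viaFintypeEmbedding_mem_columnStabilizer] using hτ
  · intro τ _ τ' _ h
    refine Perm.ext fun i => (hc.letters T).injective ?_
    rw [← Perm.viaFintypeEmbedding_apply_image, h, Perm.viaFintypeEmbedding_apply_image]
  · intro σ hσ
    obtain ⟨τ, rfl⟩ := hc.exists_viaFintypeEmbedding_eq hσ
    exact ⟨τ, by simpa using hc.viaFintypeEmbedding_mem_columnStabilizer.1 hσ, rfl⟩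
  · intro τ _
    rw [signHom_apply, Perm.viaFintypeEmbedding_sign]

end IsColumnCore

end CoreBoxes

section Shapes

theorem rowLen_ofRowLens_eq_getD {w : List ℕ} {hw : w.SortedGE} (i : ℕ) :
    (YoungDiagram.ofRowLens w hw).rowLen i = w.getD i 0 := by
  refine eq_of_forall_lt_iff fun j => ?_
  rw [← YoungDiagram.mem_iff_lt_rowLen, YoungDiagram.mem_ofRowLens]
  by_cases h : i < w.length <;> simp [h]

theorem card_cellsOfRowLens (w : List ℕ) : (YoungDiagram.cellsOfRowLens w).card = w.sum := by
  induction w with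
  | nil => rfl
  | cons a w ih =>
    rw [YoungDiagram.cellsOfRowLens, Finset.card_union_of_disjoint, Finset.card_map, ih]
    · simp
    · simp [Finset.disjoint_left]

theorem nonempty_tableau_ofRowLens {n : ℕ} {w : List ℕ} (hw : w.SortedGE) (h : w.sum = n) :
    Nonempty (Tableau n (YoungDiagram.ofRowLens w hw)) :=
  ⟨Fintype.equivFinOfCardEq (by
    rw [Fintype.card_coe, ← h, ← card_cellsOfRowLens]
    rfl)⟩

variable {n : ℕ}

theorem isColumnCore_standard (hn : 2 ≤ n) {hw : [n - 1, 1].SortedGE} :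
    IsColumnCore (YoungDiagram.ofRowLens [n - 1, 1] hw) ![(0, 0), (1, 0)] where
  injective := by decide
  mem i := by
    rw [YoungDiagram.mem_iff_lt_rowLen, rowLen_ofRowLens_eq_getD]
    fin_cases i <;> simp
    omega
  eq_of_snd_eq := by
    rintro ⟨i, j⟩ ⟨i', j'⟩ hb hb' h hbc
    simp only [YoungDiagram.mem_iff_lt_rowLen, rowLen_ofRowLens_eq_getD] at hb hb'
    rcases i with _ | _ | _ | i <;> rcases i' with _ | _ | _ | i' <;> simp_all

theorem isColumnCore_two_rows (hn : 4 ≤ n) {hw : [n - 2, 2].SortedGE} :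
    IsColumnCore (YoungDiagram.ofRowLens [n - 2, 2] hw) ![(0, 0), (1, 0), (0, 1), (1, 1)] where
  injective := by decide
  mem i := by
    rw [YoungDiagram.mem_iff_lt_rowLen, rowLen_ofRowLens_eq_getD]
    fin_cases i <;> simp <;> omega
  eq_of_snd_eq := by
    rintro ⟨i, j⟩ ⟨i', j'⟩ hb hb' h hbc
    simp only [YoungDiagram.mem_iff_lt_rowLen, rowLen_ofRowLens_eq_getD] at hb hb'
    rcases i with _ | _ | _ | i <;> rcases i' with _ | _ | _ | i' <;> simp_all <;> omega

theorem isColumnCore_hook (hn : 3 ≤ n) {hw : [n - 2, 1, 1].SortedGE} :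
    IsColumnCore (YoungDiagram.ofRowLens [n - 2, 1, 1] hw) ![(0, 0), (1, 0), (2, 0)] where
  injective := by decide
  mem i := by
    rw [YoungDiagram.mem_iff_lt_rowLen, rowLen_ofRowLens_eq_getD]
    fin_cases i <;> simp
    omega
  eq_of_snd_eq := by
    rintro ⟨i, j⟩ ⟨i', j'⟩ hb hb' h hbc
    simp only [YoungDiagram.mem_iff_lt_rowLen, rowLen_ofRowLens_eq_getD] at hb hb'
    rcases i with _ | _ | _ | i <;> rcases i' with _ | _ | _ | i' <;> simp_all

end Shapes

section TabloidsOfSmallShape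

variable {n : ℕ}

theorem Tabloid.eq_of_ne_zero {μ : YoungDiagram} {r s : Tabloid n μ}
    (h : ∀ k, s.1 k ≠ 0 → r.1 k = s.1 k) : r = s := by
  have hsub : (Finset.univ.filter fun k => r.1 k = 0) ⊆ Finset.univ.filter fun k => s.1 k = 0 := by
    intro k
    grind
  have heq := Finset.eq_of_subset_of_card_le hsub (by rw [r.2, s.2])
  refine Subtype.ext (funext fun k => ?_)
  by_cases hk : s.1 k = 0
  · rw [hk]
    exact (Finset.mem_filter.1 (heq.symm.subset (Finset.mem_filter.2 ⟨Finset.mem_univ k, hk⟩))).2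
  · exact h k hk

/-- The tabloid of shape `(n - 1, 1)` with `a` in the second row. -/
def letterTabloid {hw : [n - 1, 1].SortedGE} (a : Fin n) :
    Tabloid n (YoungDiagram.ofRowLens [n - 1, 1] hw) :=
  ⟨fun k => if k = a then 1 else 0, fun i => by
    rw [rowLen_ofRowLens_eq_getD]
    rcases i with _ | _ | i
    · rw [show (Finset.univ.filter _) = {a}ᶜ by ext; simp, Finset.card_compl]; simp
    · rw [show (Finset.univ.filter _) = {a} by grind]; simp
    · rw [show (Finset.univ.filter _) = ∅ by grind]; simp⟩

/-- The tabloid of shape `(n - 2, 2)` with `a` and `b` in the second row. -/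
def pairTabloid {hw : [n - 2, 2].SortedGE} {a b : Fin n} (hab : a ≠ b) :
    Tabloid n (YoungDiagram.ofRowLens [n - 2, 2] hw) :=
  ⟨fun k => if k = a ∨ k = b then 1 else 0, fun i => by
    rw [rowLen_ofRowLens_eq_getD]
    rcases i with _ | _ | i
    · rw [show (Finset.univ.filter _) = {a, b}ᶜ by ext; simp, Finset.card_compl,
        Finset.card_pair hab]
      simp
    · rw [show (Finset.univ.filter _) = {a, b} by grind, Finset.card_pair hab]; simp
    · rw [show (Finset.univ.filter _) = ∅ by grind]; simp⟩

/-- The tabloid of shape `(n - 2, 1, 1)` with `a` in the second and `b` in the third row. -/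
def hookTabloid {hw : [n - 2, 1, 1].SortedGE} {a b : Fin n} (hab : a ≠ b) :
    Tabloid n (YoungDiagram.ofRowLens [n - 2, 1, 1] hw) :=
  ⟨fun k => if k = a then 1 else if k = b then 2 else 0, fun i => by
    rw [rowLen_ofRowLens_eq_getD]
    rcases i with _ | _ | _ | i
    · rw [show (Finset.univ.filter _) = {a, b}ᶜ by ext; simp; grind, Finset.card_compl,
        Finset.card_pair hab]
      simp
    · rw [show (Finset.univ.filter _) = {a} by grind]; simp
    · rw [show (Finset.univ.filter _) = {b} by grind]; simp
    · rw [show (Finset.univ.filter _) = ∅ by grind]; simp⟩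

section Letter

variable {hw : [n - 1, 1].SortedGE}

theorem letterTabloid_apply (a k : Fin n) :
    (letterTabloid a : Tabloid n (YoungDiagram.ofRowLens [n - 1, 1] hw)).1 k =
      if k = a then 1 else 0 := rfl

theorem eq_letterTabloid {r : Tabloid n (YoungDiagram.ofRowLens [n - 1, 1] hw)} {a : Fin n}
    (ha : r.1 a = 1) : r = letterTabloid a :=
  Tabloid.eq_of_ne_zero fun k => by grind [letterTabloid_apply]

theorem exists_eq_letterTabloid (r : Tabloid n (YoungDiagram.ofRowLens [n - 1, 1] hw)) :
    ∃ a, r = letterTabloid a := by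
  have hcard := r.2 1
  rw [rowLen_ofRowLens_eq_getD] at hcard
  obtain ⟨a, ha⟩ := Finset.card_eq_one.1 hcard
  simp only [Finset.ext_iff, Finset.mem_filter, Finset.mem_univ,
    true_and, Finset.mem_singleton] at ha
  exact ⟨a, eq_letterTabloid ((ha a).2 rfl)⟩

theorem smul_letterTabloid (σ : Perm (Fin n)) (a : Fin n) :
    σ • (letterTabloid a : Tabloid n (YoungDiagram.ofRowLens [n - 1, 1] hw)) =
      letterTabloid (σ a) :=
  eq_letterTabloid (by simp [smul_tabloid_apply, letterTabloid_apply])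

theorem letterTabloid_injective :
    Function.Injective (letterTabloid : Fin n → Tabloid n (YoungDiagram.ofRowLens [n - 1, 1] hw)) :=
  fun a b h => by simpa [letterTabloid_apply] using congrFun (congrArg Subtype.val h) a

end Letter

section Pair

variable {hw : [n - 2, 2].SortedGE}

theorem pairTabloid_apply {a b : Fin n} (hab : a ≠ b) (k : Fin n) :
    (pairTabloid hab : Tabloid n (YoungDiagram.ofRowLens [n - 2, 2] hw)).1 k =
      if k = a ∨ k = b then 1 else 0 := rfl

theorem eq_pairTabloid {r : Tabloid n (YoungDiagram.ofRowLens [n - 2, 2] hw)} {a b : Fin n}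
    (hab : a ≠ b) (ha : r.1 a = 1) (hb : r.1 b = 1) : r = pairTabloid hab :=
  Tabloid.eq_of_ne_zero fun k => by grind [pairTabloid_apply]

theorem exists_eq_pairTabloid (r : Tabloid n (YoungDiagram.ofRowLens [n - 2, 2] hw)) :
    ∃ (a b : Fin n) (hab : a ≠ b), r = pairTabloid hab := by
  have hcard := r.2 1
  rw [rowLen_ofRowLens_eq_getD] at hcard
  obtain ⟨a, b, hab, h⟩ := Finset.card_eq_two.1 hcard
  simp only [Finset.ext_iff, Finset.mem_filter, Finset.mem_univ,
    true_and, Finset.mem_insert, Finset.mem_singleton] at h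
  exact ⟨a, b, hab, eq_pairTabloid hab ((h a).2 (.inl rfl)) ((h b).2 (.inr rfl))⟩

theorem pairTabloid_symm {a b : Fin n} (hab : a ≠ b) :
    (pairTabloid hab : Tabloid n (YoungDiagram.ofRowLens [n - 2, 2] hw)) = pairTabloid hab.symm :=
  eq_pairTabloid _ (by simp [pairTabloid_apply]) (by simp [pairTabloid_apply])

theorem pairTabloid_inj {a b c d : Fin n} {hab : a ≠ b} {hcd : c ≠ d} :
    (pairTabloid hab : Tabloid n (YoungDiagram.ofRowLens [n - 2, 2] hw)) = pairTabloid hcd ↔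
      a = c ∧ b = d ∨ a = d ∧ b = c := by
  refine ⟨fun h => ?_, ?_⟩
  · have hval := congrFun (congrArg Subtype.val h)
    have := hval a
    have := hval b
    grind [pairTabloid_apply]
  · rintro (⟨rfl, rfl⟩ | ⟨rfl, rfl⟩)
    exacts [rfl, pairTabloid_symm _]

end Pair

section Hook

variable {hw : [n - 2, 1, 1].SortedGE}

theorem hookTabloid_apply {a b : Fin n} (hab : a ≠ b) (k : Fin n) :
    (hookTabloid hab : Tabloid n (YoungDiagram.ofRowLens [n - 2, 1, 1] hw)).1 k =
      if k = a then 1 else if k = b then 2 else 0 := rfl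

theorem eq_hookTabloid {r : Tabloid n (YoungDiagram.ofRowLens [n - 2, 1, 1] hw)} {a b : Fin n}
    (hab : a ≠ b) (ha : r.1 a = 1) (hb : r.1 b = 2) : r = hookTabloid hab :=
  Tabloid.eq_of_ne_zero fun k => by grind [hookTabloid_apply]

theorem exists_eq_hookTabloid (r : Tabloid n (YoungDiagram.ofRowLens [n - 2, 1, 1] hw)) :
    ∃ (a b : Fin n) (hab : a ≠ b), r = hookTabloid hab := by
  have hcard₁ := r.2 1
  have hcard₂ := r.2 2
  rw [rowLen_ofRowLens_eq_getD] at hcard₁ hcard₂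
  obtain ⟨a, ha⟩ := Finset.card_eq_one.1 hcard₁
  obtain ⟨b, hb⟩ := Finset.card_eq_one.1 hcard₂
  simp only [Finset.ext_iff, Finset.mem_filter, Finset.mem_univ,
    true_and, Finset.mem_singleton] at ha hb
  have hab : a ≠ b := by
    rintro rfl
    simpa [(ha a).2 rfl] using (hb a).2 rfl
  exact ⟨a, b, hab, eq_hookTabloid _ ((ha a).2 rfl) ((hb b).2 rfl)⟩

theorem smul_hookTabloid (σ : Perm (Fin n)) {a b : Fin n} (hab : a ≠ b) :
    σ • (hookTabloid hab : Tabloid n (YoungDiagram.ofRowLens [n - 2, 1, 1] hw)) =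
      hookTabloid (σ.injective.ne hab) :=
  eq_hookTabloid _ (by simp [smul_tabloid_apply, hookTabloid_apply])
    (by simp [smul_tabloid_apply, hookTabloid_apply, hab.symm])

theorem hookTabloid_inj {a b c d : Fin n} {hab : a ≠ b} {hcd : c ≠ d} :
    (hookTabloid hab : Tabloid n (YoungDiagram.ofRowLens [n - 2, 1, 1] hw)) = hookTabloid hcd ↔
      a = c ∧ b = d := by
  refine ⟨fun h => ?_, fun h => by simp [h]⟩
  have hval := congrFun (congrArg Subtype.val h)
  have := hval a
  have := hval b
  grind [hookTabloid_apply]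

end Hook

end TabloidsOfSmallShape

section PolytabloidsOfSmallShape

variable {n : ℕ}

theorem IsColumnCore.tabloid_act_apply {m : ℕ} {μ : YoungDiagram} {c : Fin m → ℕ × ℕ}
    (hc : IsColumnCore μ c) (T : Tableau n μ) (τ : Perm (Fin m)) (i : Fin m) :
    (T.act (τ.viaFintypeEmbedding (hc.letters T))).tabloid.1 (hc.letters T (τ i)) = (c i).1 := by
  rw [← Perm.viaFintypeEmbedding_apply_image, Tableau.tabloid_act, smul_tabloid_apply,
    Perm.inv_def, Equiv.symm_apply_apply]
  exact hc.row_letters T i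

theorem polytabloid_standard (hn : 2 ≤ n) {hw : [n - 1, 1].SortedGE}
    (T : Tableau n (YoungDiagram.ofRowLens [n - 1, 1] hw)) :
    letI x := (isColumnCore_standard hn).letters T
    T.polytabloid = .single (letterTabloid (x 1)) 1 - .single (letterTabloid (x 0)) 1 := by
  have hperm : (Finset.univ.filter fun τ : Perm (Fin 2) =>
      ∀ i, ((![(0, 0), (1, 0)] : Fin 2 → ℕ × ℕ) (τ i)).2 = (![(0, 0), (1, 0)] i : ℕ × ℕ).2) =
      {1, swap 0 1} := by decide
  have htab (τ : Perm (Fin 2)) :=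
    eq_letterTabloid ((isColumnCore_standard (hw := hw) hn).tabloid_act_apply T τ 1)
  rw [(isColumnCore_standard hn).polytabloid_eq_sum T, hperm, Finset.sum_pair (by decide)]
  simp only [htab, map_one, signHom_swap (show (0 : Fin 2) ≠ 1 by decide)]
  simp [sub_eq_add_neg]

theorem exists_polytabloid_standard (hn : 2 ≤ n) {hw : [n - 1, 1].SortedGE} {a b : Fin n}
    (hab : a ≠ b) : ∃ T : Tableau n (YoungDiagram.ofRowLens [n - 1, 1] hw),
      T.polytabloid = .single (letterTabloid b) 1 - .single (letterTabloid a) 1 := by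
  obtain ⟨T₀⟩ := nonempty_tableau_ofRowLens (n := n) hw (by simp; omega)
  obtain ⟨T, hT⟩ := (isColumnCore_standard hn).letters_surjective T₀
    ⟨![a, b], injective_pair_iff_ne.2 hab⟩
  exact ⟨T, by rw [polytabloid_standard hn, hT]; rfl⟩

theorem polytabloid_two_rows (hn : 4 ≤ n) {hw : [n - 2, 2].SortedGE}
    (T : Tableau n (YoungDiagram.ofRowLens [n - 2, 2] hw)) :
    letI x := (isColumnCore_two_rows hn).letters T
    T.polytabloid =
      .single (pairTabloid (x.injective.ne (by decide : (1 : Fin 4) ≠ 3))) 1 -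
      .single (pairTabloid (x.injective.ne (by decide : (0 : Fin 4) ≠ 3))) 1 -
      .single (pairTabloid (x.injective.ne (by decide : (1 : Fin 4) ≠ 2))) 1 +
      .single (pairTabloid (x.injective.ne (by decide : (0 : Fin 4) ≠ 2))) 1 := by
  have hperm : (Finset.univ.filter fun τ : Perm (Fin 4) =>
      ∀ i, ((![(0, 0), (1, 0), (0, 1), (1, 1)] : Fin 4 → ℕ × ℕ) (τ i)).2 =
        (![(0, 0), (1, 0), (0, 1), (1, 1)] i : ℕ × ℕ).2) =
      {1, swap 0 1, swap 2 3, swap 0 1 * swap 2 3} := by decide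
  have htab (τ : Perm (Fin 4)) := eq_pairTabloid
    (((isColumnCore_two_rows (hw := hw) hn).letters T).injective.ne
      (τ.injective.ne (by decide : (1 : Fin 4) ≠ 3)))
    ((isColumnCore_two_rows (hw := hw) hn).tabloid_act_apply T τ 1)
    ((isColumnCore_two_rows (hw := hw) hn).tabloid_act_apply T τ 3)
  rw [(isColumnCore_two_rows hn).polytabloid_eq_sum T, hperm, Finset.sum_insert (by decide),
    Finset.sum_insert (by decide), Finset.sum_pair (by decide)]
  simp only [htab, map_one, map_mul, signHom_swap (show (0 : Fin 4) ≠ 1 by decide),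
    signHom_swap (show (2 : Fin 4) ≠ 3 by decide)]
  simp [sub_eq_add_neg, swap_apply_def, add_assoc]

theorem exists_polytabloid_two_rows (hn : 4 ≤ n) {hw : [n - 2, 2].SortedGE} {a b c d : Fin n}
    (hab : a ≠ b) (hac : a ≠ c) (had : a ≠ d) (hbc : b ≠ c) (hbd : b ≠ d) (hcd : c ≠ d) :
    ∃ T : Tableau n (YoungDiagram.ofRowLens [n - 2, 2] hw), T.polytabloid =
      .single (pairTabloid hbd) 1 - .single (pairTabloid had) 1 -
        .single (pairTabloid hbc) 1 + .single (pairTabloid hac) 1 := by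
  obtain ⟨T₀⟩ := nonempty_tableau_ofRowLens (n := n) hw (by simp; omega)
  obtain ⟨T, hT⟩ := (isColumnCore_two_rows hn).letters_surjective T₀
    ⟨![a, b, c, d], List.nodup_ofFn.1 (by simp [*])⟩
  exact ⟨T, by rw [polytabloid_two_rows hn]; simp only [hT]; rfl⟩

theorem polytabloid_hook (hn : 3 ≤ n) {hw : [n - 2, 1, 1].SortedGE}
    (T : Tableau n (YoungDiagram.ofRowLens [n - 2, 1, 1] hw)) :
    letI x := (isColumnCore_hook hn).letters T
    letI e {i j : Fin 3} (hij : i ≠ j) : MonoidAlgebra ℂ (Tabloid n _) :=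
      .single (hookTabloid (x.injective.ne hij)) 1
    T.polytabloid =
      e (by decide : (1 : Fin 3) ≠ 2) - e (by decide : (2 : Fin 3) ≠ 1) -
      e (by decide : (0 : Fin 3) ≠ 2) + e (by decide : (2 : Fin 3) ≠ 0) +
      e (by decide : (0 : Fin 3) ≠ 1) - e (by decide : (1 : Fin 3) ≠ 0) := by
  have hperm : (Finset.univ.filter fun τ : Perm (Fin 3) =>
      ∀ i, ((![(0, 0), (1, 0), (2, 0)] : Fin 3 → ℕ × ℕ) (τ i)).2 =
        (![(0, 0), (1, 0), (2, 0)] i : ℕ × ℕ).2) =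
      {1, swap 1 2, swap 0 1, swap 0 1 * swap 1 2, swap 1 2 * swap 0 1, swap 0 2} := by decide
  have htab (τ : Perm (Fin 3)) := eq_hookTabloid
    (((isColumnCore_hook (hw := hw) hn).letters T).injective.ne
      (τ.injective.ne (by decide : (1 : Fin 3) ≠ 2)))
    ((isColumnCore_hook (hw := hw) hn).tabloid_act_apply T τ 1)
    ((isColumnCore_hook (hw := hw) hn).tabloid_act_apply T τ 2)
  rw [(isColumnCore_hook hn).polytabloid_eq_sum T, hperm, Finset.sum_insert (by decide),
    Finset.sum_insert (by decide), Finset.sum_insert (by decide), Finset.sum_insert (by decide),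
    Finset.sum_pair (by decide)]
  simp only [htab, map_one, map_mul, signHom_swap (show (0 : Fin 3) ≠ 1 by decide),
    signHom_swap (show (1 : Fin 3) ≠ 2 by decide), signHom_swap (show (0 : Fin 3) ≠ 2 by decide)]
  simp [sub_eq_add_neg, swap_apply_def, add_assoc]

theorem exists_polytabloid_hook (hn : 3 ≤ n) {hw : [n - 2, 1, 1].SortedGE} {a b c : Fin n}
    (hab : a ≠ b) (hbc : b ≠ c) (hca : c ≠ a) :
    ∃ T : Tableau n (YoungDiagram.ofRowLens [n - 2, 1, 1] hw), T.polytabloid =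
      .single (hookTabloid hbc) 1 - .single (hookTabloid hbc.symm) 1 -
        .single (hookTabloid hca.symm) 1 + .single (hookTabloid hca) 1 +
        .single (hookTabloid hab) 1 - .single (hookTabloid hab.symm) 1 := by
  obtain ⟨T₀⟩ := nonempty_tableau_ofRowLens (n := n) hw (by simp; omega)
  obtain ⟨T, hT⟩ := (isColumnCore_hook hn).letters_surjective T₀
    ⟨![a, b, c], List.nodup_ofFn.1 (by simp [hca.symm, *])⟩
  exact ⟨T, by rw [polytabloid_hook hn]; simp only [hT]; rfl⟩

end PolytabloidsOfSmallShape

section TwoPointFunctions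

variable {ι k : Type*} {F : ι → ι → k}

theorem exists_forall_eq_add [Field k] (h2 : (2 : k) ≠ 0) (hι : 3 ≤ Cardinal.mk ι)
    (hsymm : ∀ a b, a ≠ b → F a b = F b a)
    (hF : ∀ a b c d, a ≠ b → a ≠ c → a ≠ d → b ≠ c → b ≠ d → c ≠ d →
      F a c + F b d = F a d + F b c) :
    ∃ p : ι → k, ∀ a b, a ≠ b → F a b = p a + p b := by
  have hp (a) : ∃ p, ∀ b c, b ≠ a → c ≠ a → b ≠ c → F a b + F a c - F b c = 2 * p := by
    obtain ⟨x, hx, -⟩ := Cardinal.exists_ne_ne_of_three_le hι a a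
    obtain ⟨y, hy, hyx⟩ := Cardinal.exists_ne_ne_of_three_le hι a x
    have hstep (b c c') (hb : b ≠ a) (hc : c ≠ a) (hc' : c' ≠ a) (hbc : b ≠ c) (hbc' : b ≠ c') :
        F a b + F a c - F b c = F a b + F a c' - F b c' := by
      obtain rfl | hcc' := eq_or_ne c c'
      · rfl
      · linear_combination hF a b c c' hb.symm hc.symm hc'.symm hbc hbc' hcc'
    refine ⟨(F a x + F a y - F x y) / 2, fun b c hb hc hbc => ?_⟩
    rw [mul_div_cancel₀ _ h2]
    obtain rfl | hcx := eq_or_ne c x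
    · linear_combination hstep c b y hc hb hy hbc.symm hyx.symm - hsymm b c hbc
    · linear_combination hstep c b x hc hb hx hbc.symm hcx +
        hstep x c y hx hc hy hcx.symm hyx.symm - hsymm b c hbc - hsymm c x hcx
  choose p hp using hp
  refine ⟨p, fun a b hab => mul_left_cancel₀ h2 ?_⟩
  obtain ⟨c, hca, hcb⟩ := Cardinal.exists_ne_ne_of_three_le hι a b
  linear_combination hp a b c hab.symm hca hcb.symm + hp b a c hab hcb hca.symm + hsymm a b hab

theorem exists_forall_sub_eq_sub [CommRing k] [Nonempty ι]
    (hF : ∀ a b c, a ≠ b → b ≠ c → c ≠ a →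
      (F a b - F b a) + (F b c - F c b) + (F c a - F a c) = 0) :
    ∃ u : ι → k, ∀ a b, F a b - F b a = u b - u a := by
  obtain ⟨o⟩ := ‹Nonempty ι›
  refine ⟨fun a => F o a - F a o, fun a b => ?_⟩
  by_cases h : a ≠ b ∧ b ≠ o ∧ o ≠ a
  · linear_combination hF a b o h.1 h.2.1 h.2.2
  · grind

theorem exists_forall_ne_eq {α : Type*} [Nonempty α] (f : ∀ a b : ι, a ≠ b → α) :
    ∃ F : ι → ι → α, ∀ a b (hab : a ≠ b), f a b hab = F a b := by
  classical
  exact ⟨fun a b => if hab : a ≠ b then f a b hab else Classical.arbitrary α,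
    fun a b hab => (dif_pos hab).symm⟩

end TwoPointFunctions

section LinearForms

variable {n : ℕ}

theorem exists_linearMap_letterTabloid {hw : [n - 1, 1].SortedGE} (p : Fin n → ℂ) :
    ∃ ψ : MonoidAlgebra ℂ (Tabloid n (YoungDiagram.ofRowLens [n - 1, 1] hw)) →ₗ[ℂ] ℂ,
      ∀ a, ψ (.single (letterTabloid a) 1) = p a := by
  choose x hx using exists_eq_letterTabloid (n := n) (hw := hw)
  refine ⟨(MonoidAlgebra.basis _ ℂ).constr ℂ (p ∘ x), fun a => ?_⟩
  rw [← MonoidAlgebra.basis_apply, Module.Basis.constr_basis, Function.comp_apply,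
    ← letterTabloid_injective (hx (letterTabloid a))]

theorem exists_linearMap_pairTabloid {hw : [n - 2, 2].SortedGE} {S : Fin n → Fin n → ℂ}
    (hS : ∀ a b, S a b = S b a) :
    ∃ ψ : MonoidAlgebra ℂ (Tabloid n (YoungDiagram.ofRowLens [n - 2, 2] hw)) →ₗ[ℂ] ℂ,
      ∀ a b (hab : a ≠ b), ψ (.single (pairTabloid hab) 1) = S a b := by
  choose x y hxy h using exists_eq_pairTabloid (n := n) (hw := hw)
  refine ⟨(MonoidAlgebra.basis _ ℂ).constr ℂ fun r => S (x r) (y r), fun a b hab => ?_⟩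
  rw [← MonoidAlgebra.basis_apply, Module.Basis.constr_basis]
  obtain ⟨ha, hb⟩ | ⟨ha, hb⟩ := pairTabloid_inj.1 (h (pairTabloid hab))
  · rw [← ha, ← hb]
  · rw [← ha, ← hb, hS]

end LinearForms

section RowSums

variable {n : ℕ} {μ : YoungDiagram} {hw : [n - 1, 1].SortedGE}

/-- The formal sum of the letters in row `i` of a tabloid, a letter `k` being regarded as the
tabloid of shape `(n - 1, 1)` with `k` in its second row. -/
def rowSum (i : ℕ) (r : Tabloid n μ) :
    MonoidAlgebra ℂ (Tabloid n (YoungDiagram.ofRowLens [n - 1, 1] hw)) :=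
  ∑ k with r.1 k = i, .single (letterTabloid k) 1

theorem rowSum_smul (i : ℕ) (σ : Perm (Fin n)) (r : Tabloid n μ) :
    rowSum i (σ • r) =
      tabloidRep n (YoungDiagram.ofRowLens [n - 1, 1] hw) σ (rowSum i r) := by
  simp only [rowSum, map_sum, tabloidRep_single, smul_letterTabloid]
  exact Finset.sum_equiv σ⁻¹ (by simp [smul_tabloid_apply]) (by simp)

theorem rowSum_one_pairTabloid {hw' : [n - 2, 2].SortedGE} {a b : Fin n} (hab : a ≠ b) :
    rowSum 1 (pairTabloid hab : Tabloid n (YoungDiagram.ofRowLens [n - 2, 2] hw')) =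
      (.single (letterTabloid a) 1 + .single (letterTabloid b) 1 :
        MonoidAlgebra ℂ (Tabloid n (YoungDiagram.ofRowLens [n - 1, 1] hw))) := by
  rw [← Finset.sum_pair (f := fun k => MonoidAlgebra.single (letterTabloid k) (1 : ℂ)) hab]
  exact Finset.sum_congr (by ext; simp [pairTabloid_apply]; grind) fun _ _ => rfl

theorem rowSum_one_hookTabloid {hw' : [n - 2, 1, 1].SortedGE} {a b : Fin n} (hab : a ≠ b) :
    rowSum 1 (hookTabloid hab : Tabloid n (YoungDiagram.ofRowLens [n - 2, 1, 1] hw')) =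
      (.single (letterTabloid a) 1 :
        MonoidAlgebra ℂ (Tabloid n (YoungDiagram.ofRowLens [n - 1, 1] hw))) := by
  rw [← Finset.sum_singleton (fun k => MonoidAlgebra.single (letterTabloid k) (1 : ℂ)) a]
  exact Finset.sum_congr (by ext; simp [hookTabloid_apply]; grind) fun _ _ => rfl

theorem rowSum_two_hookTabloid {hw' : [n - 2, 1, 1].SortedGE} {a b : Fin n} (hab : a ≠ b) :
    rowSum 2 (hookTabloid hab : Tabloid n (YoungDiagram.ofRowLens [n - 2, 1, 1] hw')) =
      (.single (letterTabloid b) 1 :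
        MonoidAlgebra ℂ (Tabloid n (YoungDiagram.ofRowLens [n - 1, 1] hw))) := by
  rw [← Finset.sum_singleton (fun k => MonoidAlgebra.single (letterTabloid k) (1 : ℂ)) b]
  exact Finset.sum_congr (by ext; simp [hookTabloid_apply]; grind) fun _ _ => rfl

end RowSums

section PermutationCharacters

variable {n : ℕ}

theorem character_defRep (σ : Perm (Fin n)) :
    (defRep n).character σ = (Finset.univ.filter fun a => σ a = a).card :=
  character_ofMulAction σ

theorem character_tabloidRep_standard {hw : [n - 1, 1].SortedGE} :
    (tabloidRep n (YoungDiagram.ofRowLens [n - 1, 1] hw)).character = (defRep n).character := by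
  classical
  have := Fintype.ofFinite (Tabloid n (YoungDiagram.ofRowLens [n - 1, 1] hw))
  ext σ
  rw [tabloidRep, character_ofMulAction, character_defRep, Nat.cast_inj]
  refine (Finset.card_bij (fun a _ => letterTabloid a) (fun a ha => ?_)
    (fun a _ b _ h => letterTabloid_injective h) fun r hr => ?_).symm
  · simpa [smul_letterTabloid, letterTabloid_injective.eq_iff] using ha
  · obtain ⟨a, rfl⟩ := exists_eq_letterTabloid r
    exact ⟨a, by simpa [smul_letterTabloid, letterTabloid_injective.eq_iff] using hr, rfl⟩

theorem character_defRep_sq {hw : [n - 2, 1, 1].SortedGE} :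
    (defRep n).character ^ 2 = (defRep n).character +
      (tabloidRep n (YoungDiagram.ofRowLens [n - 2, 1, 1] hw)).character := by
  classical
  have := Fintype.ofFinite (Tabloid n (YoungDiagram.ofRowLens [n - 2, 1, 1] hw))
  ext σ
  set A := Finset.univ.filter fun a => σ a = a with hA
  have hcard : (Finset.univ.filter fun r : Tabloid n (YoungDiagram.ofRowLens [n - 2, 1, 1] hw) =>
      σ • r = r).card = A.offDiag.card := by
    refine (Finset.card_bij
      (fun p hp => hookTabloid (Finset.mem_offDiag.1 hp).2.2) ?_ ?_ fun r hr => ?_).symm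
    · rintro ⟨a, b⟩ hp
      simpa [hA, smul_hookTabloid, hookTabloid_inj] using
        And.intro (Finset.mem_offDiag.1 hp).1 (Finset.mem_offDiag.1 hp).2.1
    · rintro ⟨a, b⟩ _ ⟨c, d⟩ _ h
      simpa using hookTabloid_inj.1 h
    · obtain ⟨a, b, hab, rfl⟩ := exists_eq_hookTabloid r
      refine ⟨(a, b), ?_, rfl⟩
      simpa [hA, smul_hookTabloid, hookTabloid_inj, hab] using hr
  rw [Pi.pow_apply, Pi.add_apply, tabloidRep, character_ofMulAction, character_defRep, hcard,
    Finset.offDiag_card, ← hA, ← Nat.cast_add, Nat.add_sub_cancel' (Nat.le_mul_self _)]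
  push_cast
  ring

end PermutationCharacters

section SpechtCharacters

variable {n : ℕ}

theorem subsingleton_tabloid_one_row {hw : [n].SortedGE} :
    Subsingleton (Tabloid n (YoungDiagram.ofRowLens [n] hw)) := by
  have hrow (r : Tabloid n (YoungDiagram.ofRowLens [n] hw)) (k : Fin n) : r.1 k = 0 := by
    have hpos := r.rowLen_pos k
    rw [rowLen_ofRowLens_eq_getD] at hpos
    rcases h : r.1 k with _ | i
    · rfl
    · simp [h] at hpos
  exact ⟨fun r s => Subtype.ext (funext fun k => by rw [hrow, hrow])⟩

theorem character_specht_one_row {hw : [n].SortedGE} :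
    (specht n (YoungDiagram.ofRowLens [n] hw)).toRepresentation.character = 1 := by
  classical
  set μ := YoungDiagram.ofRowLens [n] hw
  have : Subsingleton (Tabloid n μ) := subsingleton_tabloid_one_row
  have := Fintype.ofFinite (Tabloid n μ)
  obtain ⟨T⟩ := nonempty_tableau_ofRowLens (n := n) hw (by simp)
  have hsingle (r : Tabloid n μ) :
      T.polytabloid = T.polytabloid.coeff r • MonoidAlgebra.single r 1 := by
    ext s
    simp [Subsingleton.elim s r]
  have hcoeff (r : Tabloid n μ) : T.polytabloid.coeff r ≠ 0 := fun h =>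
    T.polytabloid_ne_zero (by rw [hsingle r, h, zero_smul])
  have hspecht := character_tabloidRep_eq_add (μ := μ)
    (τ := Representation.trivial ℂ (Perm (Fin n)) PUnit) (q := 0) (fun _ => ⟨0, rfl⟩)
    (fun _ => rfl) fun f hf => ⟨0, fun r => by
      have hr := hf T
      rw [hsingle r, map_smul] at hr
      exact (smul_eq_zero.1 hr).resolve_left (hcoeff r)⟩
  have htrivial : (Representation.trivial ℂ (Perm (Fin n)) PUnit).character = 0 := by
    ext
    simp [Representation.character]
  have hone : (tabloidRep n μ).character = 1 := by
    ext σ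
    rw [tabloidRep, character_ofMulAction, Finset.filter_true_of_mem
      (fun r _ => Subsingleton.elim _ _), Finset.card_univ,
      Fintype.card_eq_one_iff.2 ⟨T.tabloid, fun r => Subsingleton.elim _ _⟩, Nat.cast_one,
      Pi.one_apply]
  rw [hone, htrivial, add_zero] at hspecht
  exact hspecht.symm

theorem character_specht_standard (hn : 2 ≤ n) {hw : [n - 1, 1].SortedGE} :
    (defRep n).character =
      (specht n (YoungDiagram.ofRowLens [n - 1, 1] hw)).toRepresentation.character + 1 := by
  set μ := YoungDiagram.ofRowLens [n - 1, 1] hw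
  let q : IntertwiningMap (tabloidRep n μ) (Representation.trivial ℂ (Perm (Fin n)) ℂ) :=
    liftOfMulAction _ (fun _ => 1) fun _ _ => rfl
  have hq (r : Tabloid n μ) : q (.single r 1) = 1 := liftOfMulAction_single _ _ _ r
  have htriv : (Representation.trivial ℂ (Perm (Fin n)) ℂ).character = 1 := by
    ext σ
    simp [Representation.character]
  rw [← character_tabloidRep_standard (hw := hw), ← htriv]
  refine character_tabloidRep_eq_add (q := q) (fun c => ?_) (fun T => ?_) fun f hf => ?_
  · refine ⟨c • .single (letterTabloid ⟨0, by omega⟩) 1, ?_⟩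
    rw [map_smul, hq, smul_eq_mul, mul_one]
  · rw [polytabloid_standard hn, map_sub, hq, hq, sub_self]
  · refine ⟨LinearMap.toSpanSingleton ℂ ℂ (f (.single (letterTabloid ⟨0, by omega⟩) 1)),
      fun r => ?_⟩
    obtain ⟨a, rfl⟩ := exists_eq_letterTabloid r
    rw [hq, LinearMap.toSpanSingleton_apply, one_smul]
    obtain rfl | ha := eq_or_ne a ⟨0, by omega⟩
    · rfl
    · obtain ⟨T, hT⟩ := exists_polytabloid_standard hn (hw := hw) ha.symm
      rw [← sub_eq_zero, ← map_sub, ← hT, hf]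

theorem three_le_mk_fin (hn : 3 ≤ n) : 3 ≤ Cardinal.mk (Fin n) := by
  rw [Cardinal.mk_fin]
  exact_mod_cast hn

theorem exists_apply_pairTabloid_eq_add (hn : 4 ≤ n) {hw : [n - 2, 2].SortedGE}
    {f : MonoidAlgebra ℂ (Tabloid n (YoungDiagram.ofRowLens [n - 2, 2] hw)) →ₗ[ℂ] ℂ}
    (hf : ∀ T : Tableau n _, f T.polytabloid = 0) :
    ∃ p : Fin n → ℂ, ∀ a b (hab : a ≠ b), f (.single (pairTabloid hab) 1) = p a + p b := by
  obtain ⟨F, hF⟩ := exists_forall_ne_eq fun a b hab => f (.single (pairTabloid hab) 1)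
  simp only [hF]
  refine exists_forall_eq_add two_ne_zero (three_le_mk_fin (by omega)) (fun a b hab => ?_)
    fun a b c d hab hac had hbc hbd hcd => ?_
  · rw [← hF a b hab, ← hF b a hab.symm, pairTabloid_symm]
  · obtain ⟨T, hT⟩ := exists_polytabloid_two_rows hn (hw := hw) hab hac had hbc hbd hcd
    have hfT := hf T
    rw [hT, map_add, map_sub, map_sub, hF, hF, hF, hF] at hfT
    linear_combination hfT

theorem character_specht_two_rows (hn : 4 ≤ n) {hw : [n - 2, 2].SortedGE} :
    (tabloidRep n (YoungDiagram.ofRowLens [n - 2, 2] hw)).character =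
      (specht n (YoungDiagram.ofRowLens [n - 2, 2] hw)).toRepresentation.character +
        (defRep n).character := by
  have hw₂ : [n - 1, 1].SortedGE := by simp [List.sortedGE_iff_pairwise]; omega
  have hn₃ := three_le_mk_fin (by omega : 3 ≤ n)
  set μ := YoungDiagram.ofRowLens [n - 2, 2] hw
  let q : IntertwiningMap (tabloidRep n μ) (tabloidRep n (.ofRowLens [n - 1, 1] hw₂)) :=
    liftOfMulAction _ (rowSum 1) (rowSum_smul 1)
  have hq {a b : Fin n} (hab : a ≠ b) : q (.single (pairTabloid hab) 1) =
      .single (letterTabloid a) 1 + .single (letterTabloid b) 1 :=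
    (liftOfMulAction_single _ _ _ _).trans (rowSum_one_pairTabloid hab)
  rw [← character_tabloidRep_standard (hw := hw₂)]
  refine character_tabloidRep_eq_add (q := q) ?_ (fun T => ?_) fun f hf => ?_
  · rw [← IntertwiningMap.coe_toLinearMap, ← LinearMap.range_eq_top, eq_top_iff,
      ← (MonoidAlgebra.basis _ ℂ).span_eq, Submodule.span_le]
    rintro _ ⟨r, rfl⟩
    obtain ⟨a, rfl⟩ := exists_eq_letterTabloid r
    obtain ⟨b, hba, -⟩ := Cardinal.exists_ne_ne_of_three_le hn₃ a a
    obtain ⟨c, hca, hcb⟩ := Cardinal.exists_ne_ne_of_three_le hn₃ a b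
    refine ⟨(2⁻¹ : ℂ) • (.single (pairTabloid hba.symm) 1 + .single (pairTabloid hca.symm) 1 -
      .single (pairTabloid hcb.symm) 1), ?_⟩
    rw [IntertwiningMap.coe_toLinearMap, map_smul, map_sub, map_add, hq, hq, hq,
      MonoidAlgebra.basis_apply]
    module
  · rw [polytabloid_two_rows hn, map_add, map_sub, map_sub, hq, hq, hq, hq]
    abel
  · obtain ⟨p, hp⟩ := exists_apply_pairTabloid_eq_add hn hf
    obtain ⟨ψ, hψ⟩ := exists_linearMap_letterTabloid (hw := hw₂) p
    refine ⟨ψ, fun r => ?_⟩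
    obtain ⟨a, b, hab, rfl⟩ := exists_eq_pairTabloid r
    rw [hq, map_add, hψ, hψ, hp]

theorem exists_apply_hookTabloid_sub_eq_sub (hn : 3 ≤ n) {hw : [n - 2, 1, 1].SortedGE}
    {f : MonoidAlgebra ℂ (Tabloid n (YoungDiagram.ofRowLens [n - 2, 1, 1] hw)) →ₗ[ℂ] ℂ}
    (hf : ∀ T : Tableau n _, f T.polytabloid = 0) :
    ∃ u : Fin n → ℂ, ∀ a b (hab : a ≠ b),
      f (.single (hookTabloid hab) 1) - f (.single (hookTabloid hab.symm) 1) = u b - u a := by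
  obtain ⟨F, hF⟩ := exists_forall_ne_eq fun a b hab => f (.single (hookTabloid hab) 1)
  have : Nonempty (Fin n) := ⟨⟨0, by omega⟩⟩
  obtain ⟨u, hu⟩ : ∃ u : Fin n → ℂ, ∀ a b, F a b - F b a = u b - u a := by
    refine exists_forall_sub_eq_sub fun a b c hab hbc hca => ?_
    obtain ⟨T, hT⟩ := exists_polytabloid_hook hn (hw := hw) hab hbc hca
    have hfT := hf T
    simp only [hT, map_add, map_sub, hF] at hfT
    linear_combination hfT
  exact ⟨u, fun a b hab => by rw [hF, hF, hu]⟩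

/-- The tabloid of shape `(n - 2, 2)` obtained by merging the last two rows. -/
def mergeRows {hw : [n - 2, 1, 1].SortedGE} {hw' : [n - 2, 2].SortedGE}
    (r : Tabloid n (YoungDiagram.ofRowLens [n - 2, 1, 1] hw)) :
    Tabloid n (YoungDiagram.ofRowLens [n - 2, 2] hw') :=
  ⟨fun k => min (r.1 k) 1, fun i => by
    obtain ⟨a, b, hab, rfl⟩ := exists_eq_hookTabloid r
    rw [← (pairTabloid hab).2 i]
    congr! 4 with k
    grind [pairTabloid_apply, hookTabloid_apply]⟩

theorem mergeRows_hookTabloid {hw : [n - 2, 1, 1].SortedGE} {hw' : [n - 2, 2].SortedGE}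
    {a b : Fin n} (hab : a ≠ b) :
    mergeRows (hw := hw) (hw' := hw') (hookTabloid hab) = pairTabloid hab :=
  eq_pairTabloid hab (by simp [mergeRows, hookTabloid_apply])
    (by simp [mergeRows, hookTabloid_apply, hab.symm])

/-- The homomorphism `M^(n-2,1,1) → M^(n-2,2)` that merges the last two rows. -/
def mergeRowsMap (hw : [n - 2, 1, 1].SortedGE) (hw' : [n - 2, 2].SortedGE) :
    IntertwiningMap (tabloidRep n (.ofRowLens [n - 2, 1, 1] hw))
      (tabloidRep n (.ofRowLens [n - 2, 2] hw')) :=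
  liftOfMulAction _ (fun r => .single (mergeRows r) 1) fun σ r => by
    rw [tabloidRep_single]
    rfl

theorem mergeRowsMap_single {hw : [n - 2, 1, 1].SortedGE} {hw' : [n - 2, 2].SortedGE}
    {a b : Fin n} (hab : a ≠ b) :
    mergeRowsMap hw hw' (.single (hookTabloid hab) 1) = .single (pairTabloid hab) 1 :=
  (liftOfMulAction_single _ _ _ _).trans (by rw [mergeRows_hookTabloid])

theorem rowSum_two_sub_rowSum_one_mem_specht (hn : 2 ≤ n) {hw : [n - 2, 1, 1].SortedGE}
    {hw' : [n - 1, 1].SortedGE} (r : Tabloid n (YoungDiagram.ofRowLens [n - 2, 1, 1] hw)) :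
    rowSum 2 r - rowSum 1 r ∈
      (specht n (YoungDiagram.ofRowLens [n - 1, 1] hw')).toSubmodule := by
  obtain ⟨a, b, hab, rfl⟩ := exists_eq_hookTabloid r
  obtain ⟨T, hT⟩ := exists_polytabloid_standard hn (hw := hw') hab
  rw [rowSum_one_hookTabloid, rowSum_two_hookTabloid, ← hT]
  exact polytabloid_mem_specht T

/-- The homomorphism `M^(n-2,1,1) → S^(n-1,1)` that takes the letter in the last row minus the
letter in the second row. -/
def rowDiffMap (hn : 2 ≤ n) (hw : [n - 2, 1, 1].SortedGE) (hw' : [n - 1, 1].SortedGE) :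
    IntertwiningMap (tabloidRep n (.ofRowLens [n - 2, 1, 1] hw))
      (specht n (.ofRowLens [n - 1, 1] hw')).toRepresentation :=
  liftOfMulAction _
    (fun r => ⟨rowSum 2 r - rowSum 1 r, rowSum_two_sub_rowSum_one_mem_specht hn r⟩)
    fun σ r => Subtype.ext <| by
      change rowSum 2 (σ • r) - rowSum 1 (σ • r) = tabloidRep n _ σ (rowSum 2 r - rowSum 1 r)
      rw [rowSum_smul, rowSum_smul, map_sub]

theorem coe_rowDiffMap_single (hn : 2 ≤ n) {hw : [n - 2, 1, 1].SortedGE}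
    {hw' : [n - 1, 1].SortedGE} {a b : Fin n} (hab : a ≠ b) :
    (rowDiffMap hn hw hw' (.single (hookTabloid hab) 1)).1 =
      .single (letterTabloid b) 1 - .single (letterTabloid a) 1 :=
  (congrArg Subtype.val (liftOfMulAction_single _ _ _ _)).trans
    (congrArg₂ (· - ·) (rowSum_two_hookTabloid hab) (rowSum_one_hookTabloid hab))

theorem mergeRowsMap_polytabloid (hn : 3 ≤ n) {hw : [n - 2, 1, 1].SortedGE}
    {hw' : [n - 2, 2].SortedGE} (T : Tableau n (.ofRowLens [n - 2, 1, 1] hw)) :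
    mergeRowsMap hw hw' T.polytabloid = 0 := by
  have hne {i j : Fin 3} (hij : i ≠ j) := ((isColumnCore_hook hn).letters T).injective.ne hij
  rw [polytabloid_hook hn]
  simp only [map_add, map_sub, mergeRowsMap_single]
  rw [pairTabloid_symm (hne (by decide : (2 : Fin 3) ≠ 1)),
    pairTabloid_symm (hne (by decide : (2 : Fin 3) ≠ 0)),
    pairTabloid_symm (hne (by decide : (1 : Fin 3) ≠ 0))]
  abel

theorem rowDiffMap_polytabloid (hn : 3 ≤ n) {hw : [n - 2, 1, 1].SortedGE}
    {hw' : [n - 1, 1].SortedGE} (T : Tableau n (.ofRowLens [n - 2, 1, 1] hw)) :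
    rowDiffMap (by omega) hw hw' T.polytabloid = 0 := by
  refine Subtype.ext ?_
  rw [polytabloid_hook hn]
  simp only [map_add, map_sub, Submodule.coe_add, AddSubgroupClass.coe_sub, coe_rowDiffMap_single,
    ZeroMemClass.coe_zero]
  abel

theorem mergeRowsMap_surjective {hw : [n - 2, 1, 1].SortedGE} {hw' : [n - 2, 2].SortedGE} :
    Function.Surjective (mergeRowsMap hw hw') := by
  rw [← IntertwiningMap.coe_toLinearMap, ← LinearMap.range_eq_top, eq_top_iff,
    ← (MonoidAlgebra.basis _ ℂ).span_eq, Submodule.span_le]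
  rintro _ ⟨r, rfl⟩
  obtain ⟨a, b, hab, rfl⟩ := exists_eq_pairTabloid r
  exact ⟨_, mergeRowsMap_single hab⟩

theorem rowDiffMap_surjective (hn : 2 ≤ n) {hw : [n - 2, 1, 1].SortedGE}
    {hw' : [n - 1, 1].SortedGE} : Function.Surjective (rowDiffMap hn hw hw') := by
  have hle : (specht n (.ofRowLens [n - 1, 1] hw')).toSubmodule ≤
      (rowDiffMap hn hw hw').toLinearMap.range.map (Submodule.subtype _) := by
    refine specht_le_iff.2 fun T => ?_
    rw [polytabloid_standard hn, ← coe_rowDiffMap_single hn (hw := hw)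
      (((isColumnCore_standard hn).letters T).injective.ne (by decide : (0 : Fin 2) ≠ 1))]
    exact ⟨_, ⟨_, rfl⟩, rfl⟩
  intro w
  obtain ⟨_, ⟨v, rfl⟩, hv⟩ := hle w.2
  exact ⟨v, Subtype.ext hv⟩

theorem ker_mergeRowsMap_sup_ker_rowDiffMap (hn : 2 ≤ n) {hw₂ : [n - 1, 1].SortedGE}
    {hw₃ : [n - 2, 2].SortedGE} {hw₄ : [n - 2, 1, 1].SortedGE} :
    (mergeRowsMap hw₄ hw₃).toLinearMap.ker ⊔ (rowDiffMap hn hw₄ hw₂).toLinearMap.ker = ⊤ := by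
  rw [eq_top_iff, ← (MonoidAlgebra.basis _ ℂ).span_eq, Submodule.span_le]
  rintro _ ⟨r, rfl⟩
  obtain ⟨a, b, hab, rfl⟩ := exists_eq_hookTabloid r
  rw [MonoidAlgebra.basis_apply]
  set x : MonoidAlgebra ℂ (Tabloid n (.ofRowLens [n - 2, 1, 1] hw₄)) :=
    .single (hookTabloid hab) 1
  set y : MonoidAlgebra ℂ (Tabloid n (.ofRowLens [n - 2, 1, 1] hw₄)) :=
    .single (hookTabloid hab.symm) 1
  refine Submodule.mem_sup.2 ⟨(2⁻¹ : ℂ) • (x - y), Submodule.smul_mem _ _ ?_,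
    (2⁻¹ : ℂ) • (x + y), Submodule.smul_mem _ _ ?_, by module⟩
  · rw [LinearMap.mem_ker, map_sub, IntertwiningMap.coe_toLinearMap, mergeRowsMap_single,
      mergeRowsMap_single, pairTabloid_symm, sub_self]
  · rw [LinearMap.mem_ker, map_add, IntertwiningMap.coe_toLinearMap]
    refine Subtype.ext ?_
    rw [Submodule.coe_add, coe_rowDiffMap_single, coe_rowDiffMap_single]
    simp

theorem character_specht_hook (hn : 3 ≤ n) {hw₂ : [n - 1, 1].SortedGE}
    {hw₃ : [n - 2, 2].SortedGE} {hw₄ : [n - 2, 1, 1].SortedGE} :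
    (tabloidRep n (.ofRowLens [n - 2, 1, 1] hw₄)).character =
      (specht n (.ofRowLens [n - 2, 1, 1] hw₄)).toRepresentation.character +
        ((tabloidRep n (.ofRowLens [n - 2, 2] hw₃)).character +
          (specht n (.ofRowLens [n - 1, 1] hw₂)).toRepresentation.character) := by
  have hn₂ : 2 ≤ n := by omega
  rw [← character_prod]
  refine character_tabloidRep_eq_add
    (q := (mergeRowsMap hw₄ hw₃).prod (rowDiffMap hn₂ hw₄ hw₂)) ?_ (fun T => ?_) fun f hf => ?_
  · rw [← IntertwiningMap.coe_toLinearMap, ← LinearMap.range_eq_top]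
    refine (LinearMap.range_prod_eq (ker_mergeRowsMap_sup_ker_rowDiffMap hn₂)).trans ?_
    rw [LinearMap.range_eq_top.2 mergeRowsMap_surjective,
      LinearMap.range_eq_top.2 (rowDiffMap_surjective hn₂), Submodule.prod_top]
  · exact Prod.ext (mergeRowsMap_polytabloid hn T) (rowDiffMap_polytabloid hn T)
  · obtain ⟨u, hu⟩ := exists_apply_hookTabloid_sub_eq_sub hn hf
    obtain ⟨F, hF⟩ := exists_forall_ne_eq fun a b hab => f (.single (hookTabloid hab) 1)
    obtain ⟨ψ₁, hψ₁⟩ := exists_linearMap_pairTabloid (hw := hw₃)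
      (S := fun a b => (F a b + F b a) / 2) fun a b => by rw [add_comm]
    obtain ⟨ψ₂, hψ₂⟩ := exists_linearMap_letterTabloid (hw := hw₂) fun a => u a / 2
    refine ⟨ψ₁.coprod (ψ₂ ∘ₗ Submodule.subtype _), fun r => ?_⟩
    obtain ⟨a, b, hab, rfl⟩ := exists_eq_hookTabloid r
    change _ = ψ₁ (mergeRowsMap hw₄ hw₃ _) + ψ₂ (rowDiffMap hn₂ hw₄ hw₂ _).1
    rw [mergeRowsMap_single, coe_rowDiffMap_single, map_sub, hψ₁, hψ₂, hψ₂]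
    linear_combination hu a b hab / 2 + hF a b hab / 2 + hF b a hab.symm / 2

end SpechtCharacters

theorem character_defRep_tprod_defRep {n : ℕ} (hn : 4 ≤ n) {hw₁ : [n].SortedGE}
    {hw₂ : [n - 1, 1].SortedGE} {hw₃ : [n - 2, 2].SortedGE} {hw₄ : [n - 2, 1, 1].SortedGE} :
    ((defRep n).tprod (defRep n)).character =
      2 • (specht n (.ofRowLens [n] hw₁)).toRepresentation.character +
        3 • (specht n (.ofRowLens [n - 1, 1] hw₂)).toRepresentation.character +
        (specht n (.ofRowLens [n - 2, 2] hw₃)).toRepresentation.character +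
        (specht n (.ofRowLens [n - 2, 1, 1] hw₄)).toRepresentation.character := by
  rw [char_tensor, ← sq, character_defRep_sq (hw := hw₄),
    character_specht_hook (by omega) (hw₂ := hw₂) (hw₃ := hw₃), character_specht_two_rows hn,
    character_specht_standard (by omega) (hw := hw₂), character_specht_one_row]
  abel

theorem altSpecht_ofRowLens_isIrreducible {n : ℕ} {w : List ℕ} {hw : w.SortedGE} (h : w.sum = n)
    (hμ : (YoungDiagram.ofRowLens w hw).transpose ≠ YoungDiagram.ofRowLens w hw) :
    (altSpecht n (.ofRowLens w hw)).IsIrreducible :=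
  have := nonempty_tableau_ofRowLens hw h
  altSpecht_isIrreducible hμ

end SpechtTheory

end

theorem mainTheorem7 (n : ℕ) (hn : 4 ≤ n) :
    let l₁ := YoungDiagram.ofRowLens [n] (by simp [List.sortedGE_iff_pairwise])
    let l₂ := YoungDiagram.ofRowLens [n - 1, 1] (by simp [List.sortedGE_iff_pairwise]; omega)
    let l₃ := YoungDiagram.ofRowLens [n - 2, 2] (by simp [List.sortedGE_iff_pairwise]; omega)
    let l₄ := YoungDiagram.ofRowLens [n - 2, 1, 1] (by simp [List.sortedGE_iff_pairwise]; omega)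
    (SpechtTheory.resAlt
        ((SpechtTheory.defRep n).tprod (SpechtTheory.defRep n))).character =
      2 • (SpechtTheory.altSpecht n l₁).character +
        3 • (SpechtTheory.altSpecht n l₂).character +
        (SpechtTheory.altSpecht n l₃).character +
        (SpechtTheory.altSpecht n l₄).character ∧
    ∀ μ ∈ ({l₁, l₂, l₃, l₄} : Set YoungDiagram), μ.transpose ≠ μ →
      (SpechtTheory.altSpecht n μ).IsIrreducible := by
  intro l₁ l₂ l₃ l₄
  refine ⟨funext fun g => congrFun (SpechtTheory.character_defRep_tprod_defRep hn) g.1, ?_⟩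
  rintro μ (rfl | rfl | rfl | rfl) <;>
    exact SpechtTheory.altSpecht_ofRowLens_isIrreducible (by
      simp only [List.sum_cons, List.sum_nil]
      omega)
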